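/- For $y>0$ put $q=e^{-\pi y}$ and $$\theta_2(y)=\sum_{n\in\mathbb Z}q^{(n-1/2)^2},\quad \theta_3(y)=\sum_{n\in\mathbb Z}q^{n^2},\quad \theta_4(y)=\sum_{n\in\mathbb Z}(-1)^nq^{n^2},\quad \lambda=\left(\frac{\theta_2}{\theta_3}\right)^4 .$$ Let $a$ be the multiplicative function with $a(p^f)=\sigma_1(p^f)$ for odd primes $p$ and $a(2^f)=2^f$. Put $a_2(n)=2\bigl(4-2(-1)^n\bigr)a(n)$ for $n\ge 1$, and let $b_2(m)$, $m\ge 1$, be the coefficients of the (formal) $q$-expansion of $\theta_3^2\lambda=\theta_2^4/\theta_3^2$. Let $\chi$ be the non-principal Dirichlet character modulo $4$, let $$\zeta^*(s,2)=\pi^{-s}\,\Gamma(s)\,\zeta(s)\,L(s,\chi),$$ regarded as a meromorphic function on $\mathbb C$ (removable singularities removed), and for $w\in\mathbb C$, $x>0$ let $K_w(x)=\frac12\int_0^\infty u^{w-1}e^{-\frac x2(u+\frac1u)}\,du$. For $s\in\mathbb C$ and $j\ge 1$ put $$c_j(2,s)=\sum_{d\mid j}a_2(d)\,b_2\!\left(\frac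 jd\right)\left(\frac{j}{d^2}\right)^{s/2},\qquad \Psi_2(s)=2\pi\sum_{j=1}^\infty c_j(2,s)\,K_s(2\pi\sqrt j).$$ **Theorem.** 1. For every $y>0$, with convergent series and with dots denoting $d/dy$, $$4\frac{\dot\theta_4}{\theta_4}-2\frac{\dot\theta_3}{\theta_3}=\pi\sum_{n=1}^\infty a_2(n)q^n,\qquad \theta_3^2\lambda=\sum_{m=1}^\infty b_2(m)q^m .$$ 2. For $0<\operatorname{Re}s<1$, with an absolutely convergent integral, $\zeta^*(s,2)=\frac14\int_0^\infty y^{s-1}\left(\theta_3(y)^2-1-\frac1y\right)dy$. For every complex $s\notin\{1,0,-1,-2,\dots\}$ the value $\zeta^*(s,2)$ is the product $\pi^{-s}\Gamma(s)\zeta(s)L(s,\chi)$ itself. 3. The series defining $\Psi_2(s)$ converges absolutely for every $s\in\mathbb C$. 4. For every $s\in\mathbb C\setminus\{0,1\}$, $$4\,\zeta^*(s,2)=-\left(\frac{\Psi_2(s)}{s}+\frac{\Psi_2(1-s)}{1-s}\right).$$ -/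

import Mathlib

open MeasureTheory Set

namespace BesselZeta

noncomputable section

/-! Theta functions of a real variable `y > 0`, with nome `q = exp (-π y)`. -/

/-- The nome `q = exp (-π y)`. -/
def nome (y : ℝ) : ℝ := Real.exp (-Real.pi * y)

/-- `θ₂(y) = ∑_{n ∈ ℤ} q^((n - 1/2)^2)`. -/
def theta2 (y : ℝ) : ℝ := ∑' n : ℤ, Real.exp (-Real.pi * y * ((n : ℝ) - 1 / 2) ^ 2)

/-- `θ₃(y) = ∑_{n ∈ ℤ} q^(n^2)`. -/
def theta3 (y : ℝ) : ℝ := ∑' n : ℤ, Real.exp (-Real.pi * y * (n : ℝ) ^ 2)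

/-- `θ₄(y) = ∑_{n ∈ ℤ} (-1)^n q^(n^2)`. -/
def theta4 (y : ℝ) : ℝ := ∑' n : ℤ, (-1 : ℝ) ^ n * Real.exp (-Real.pi * y * (n : ℝ) ^ 2)

/-- `λ = (θ₂ / θ₃)^4`. -/
def lam (y : ℝ) : ℝ := (theta2 y / theta3 y) ^ 4

/-- The multiplicative function with `a(p^f) = σ₁(p^f)` for odd primes `p` and `a(2^f) = 2^f`
(used only at `n ≥ 1`). -/
def a (n : ℕ) : ℕ :=
  n.factorization.prod fun p f => if p = 2 then 2 ^ f else ArithmeticFunction.sigma 1 (p ^ f)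

/-- `a₂(n) = 2 (4 - 2 (-1)^n) a(n)`, so that
`4 θ₄'/θ₄ - 2 θ₃'/θ₃ = π ∑_{n ≥ 1} a₂(n) q^n` (derivatives in `y`). -/
def a2 (n : ℕ) : ℝ := 2 * (4 - 2 * (-1 : ℝ) ^ n) * (a n : ℝ)

open scoped Classical in
/-- The formal `q`-expansion of `θ₃ = 1 + 2 ∑_{k ≥ 1} q^(k^2)`. -/
def theta3Series : PowerSeries ℝ :=
  PowerSeries.mk fun n => if n = 0 then 1 else if IsSquare n then 2 else 0

open scoped Classical in
/-- The formal `q`-expansion of `θ₂^4 = (2 q^(1/4) ∑_{k ≥ 0} q^(k (k + 1)))^4`. -/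
def theta2Pow4Series : PowerSeries ℝ :=
  16 * PowerSeries.X *
    (PowerSeries.mk fun n => if ∃ k : ℕ, n = k * (k + 1) then (1 : ℝ) else 0) ^ 4

/-- The coefficients of the `q`-expansion of `θ₃^2 λ = θ₂^4 / θ₃^2`. -/
def b2 (m : ℕ) : ℝ := PowerSeries.coeff m (theta2Pow4Series * (theta3Series ^ 2)⁻¹)

/-- The Bessel function `K_w(x) = (1/2) ∫_0^∞ u^(w-1) exp(-(x/2)(u + 1/u)) du`, for `x > 0`. -/
def besselK (w : ℂ) (x : ℝ) : ℂ :=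
  1 / 2 * ∫ u in Ioi (0 : ℝ), (u : ℂ) ^ (w - 1) * (Real.exp (-(x / 2) * (u + 1 / u)) : ℂ)

/-- `c_j(2, s) = ∑_{d ∣ j} a₂(d) b₂(j/d) (j/d^2)^(s/2)`. -/
def c2 (j : ℕ) (s : ℂ) : ℂ :=
  ∑ d ∈ j.divisors, (a2 d : ℂ) * (b2 (j / d) : ℂ) * ((j : ℂ) / (d : ℂ) ^ 2) ^ (s / 2)

/-- The `j`-th term `c_j(2, s) K_s(2π √j)` of the Bessel series. -/
def besselTerm (s : ℂ) (j : ℕ) : ℂ := c2 j s * besselK s (2 * Real.pi * Real.sqrt j)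

/-- `Ψ₂(s) = 2π ∑_{j ≥ 1} c_j(2, s) K_s(2π √j)`. -/
def Psi2 (s : ℂ) : ℂ := 2 * Real.pi * ∑' j : ℕ, besselTerm s (j + 1)

/-- The non-principal Dirichlet character modulo `4`. -/
def chi : DirichletCharacter ℂ 4 := ZMod.χ₄.ringHomComp (Int.castRingHom ℂ)

/-- The product `π^(-s) Γ(s) ζ(s) L(s, χ)`. -/
def zetaProduct (s : ℂ) : ℂ :=
  (Real.pi : ℂ) ^ (-s) * Complex.Gamma s * riemannZeta s * chi.LFunction s

/-- `ζ*(s, 2)`: the meromorphic function `π^(-s) Γ(s) ζ(s) L(s, χ)` on `ℂ`, with its removable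
singularities (where a pole of `Γ` meets a zero of `ζ(s) L(s, χ)`) filled in. -/
def zetaStar2 : ℂ → ℂ := toMeromorphicNFOn zetaProduct univ

end

end BesselZeta

namespace BesselZeta

noncomputable section

open Filter Topology

/-! Put h = θ₄⁴/θ₃² (`thetaQuot`). Dividing Jacobi's identity θ₃⁴ = θ₂⁴ + θ₄⁴ by θ₃² splits θ₃² into
h and θ₂⁴/θ₃², and the inversion y ↦ 1/y turns the second piece into y⁻¹h(1/y). Hence θ₃² - 1 - 1/y
= (h(y) - 1) + y⁻¹(h(1/y) - 1) (`thetaQuot_add`), and in the critical strip the Mellin transform of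
the left side is M(s) + M(1-s), with M the Mellin transform of h - 1.

Integration by parts gives sM(s) = -∫ y^(s-1) (y h'(y)) dy (`Psi2_eq_neg_mul_mellin`). Here y h' is
the logarithmic derivative 4θ₄'/θ₄ - 2θ₃'/θ₃ at y times y h(y), which is θ₂⁴/θ₃² at 1/y. Multiplying
the two q-expansions gives π ∑ a₂(d) b₂(m) exp(-π(dy + m/y)) (`psiKernel_eq`); each term has a
K-Bessel function as Mellin transform (`mellin_besselKernel`), and collecting the terms with dm = j
yields Ψ₂. Both sides of the resulting identity, multiplied by s(1-s), are entire, so it extends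
from the strip.

Two inputs need more than formal work. The Mellin transform of θ₃² - 1 is 4ζ*(s,2) by Jacobi's
two-square theorem, proved by counting Gaussian integers of given norm. And the double series must
converge absolutely although only an exponential-type bound on b₂ is available: Gauss's product
shows that θ₃ has no zeros in the disc and that its modulus on a circle |q| = r is at least the
value of θ₄ at r, so Cauchy's estimate bounds b₂(m) on every circle (`abs_b2_le`), and a circle
chosen in terms of y is good enough (`abs_doubleTerm_le`). The same product gives the Lambert series
behind a₂. -/

/-! ### Jacobi's two-square theorem -/

/-- The Gaussian integers of norm `n`. -/
def gaussSphere (n : ℕ) : Set GaussianInt := {z | z.norm = n}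

lemma mem_gaussSphere {n : ℕ} {z : GaussianInt} : z ∈ gaussSphere n ↔ z.norm = n := Iff.rfl

lemma gaussSphere_finite (n : ℕ) : (gaussSphere n).Finite := by
  have h : Set.Finite ((fun p : ℤ × ℤ => (⟨p.1, p.2⟩ : GaussianInt)) ''
      (Set.Icc (-(n : ℤ)) n ×ˢ Set.Icc (-(n : ℤ)) n)) :=
    ((Set.finite_Icc _ _).prod (Set.finite_Icc _ _)).image _
  refine h.subset fun z hz => ⟨(z.re, z.im), ?_, rfl⟩
  rw [mem_gaussSphere, Zsqrtd.norm_def] at hz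
  have h1 : z.re ^ 2 + z.im ^ 2 = n := by linarith [hz, sq z.re, sq z.im]
  refine ⟨⟨?_, ?_⟩, ⟨?_, ?_⟩⟩ <;> dsimp only <;>
    nlinarith [sq_nonneg z.re, sq_nonneg z.im, sq_nonneg (z.re - 1), sq_nonneg (z.im - 1),
      sq_nonneg (z.re + 1), sq_nonneg (z.im + 1), Int.le_self_sq z.re, Int.le_self_sq z.im,
      Int.le_self_sq (-z.re), Int.le_self_sq (-z.im)]

/-- The number of representations of `n` as a sum of two squares. -/
def sumTwoSqCount (n : ℕ) : ℤ := (gaussSphere n).ncard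

lemma ncard_mul_gaussSphere {c : GaussianInt} (hc : c ≠ 0) (n : ℕ) :
    ((((c * ·) '' gaussSphere n).ncard : ℕ) : ℤ) = sumTwoSqCount n := by
  rw [sumTwoSqCount, Set.ncard_image_of_injective _ (mul_right_injective₀ hc)]

/-- Multiplication by 1 + i is a bijection onto the elements of norm 2n: an even norm forces re + im
to be even, which is divisibility by 1 + i. -/
lemma sumTwoSqCount_two_mul (n : ℕ) : sumTwoSqCount (2 * n) = sumTwoSqCount n := by
  have hc : (⟨1, 1⟩ : GaussianInt) ≠ 0 := fun h => by simpa using congrArg Zsqrtd.re h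
  rw [← ncard_mul_gaussSphere hc n, sumTwoSqCount]
  congr 2
  ext z
  constructor
  · intro hz
    rw [mem_gaussSphere, Zsqrtd.norm_def] at hz
    push_cast at hz
    obtain ⟨k, hk⟩ : (2 : ℤ) ∣ z.re + z.im := by
      have : Even (z.re * z.re + z.im * z.im) := ⟨n, by linarith⟩
      rw [Int.even_add, Int.even_mul, Int.even_mul] at this
      exact even_iff_two_dvd.1 (Int.even_add.2 (by simpa using this))
    -- The quotient z/(1 + i) = ((re + im) + (im - re)i)/2, with re + im = 2k.
    refine ⟨⟨k, k - z.re⟩, ?_, ?_⟩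
    · rw [mem_gaussSphere, Zsqrtd.norm_def]
      have h2 : z.im = 2 * k - z.re := by linarith
      rw [h2] at hz
      dsimp only
      linarith
    · ext
      · simp [Zsqrtd.re_mul]
      · simp [Zsqrtd.im_mul]
        linarith
  · rintro ⟨w, hw, rfl⟩
    rw [mem_gaussSphere] at hw ⊢
    dsimp only
    rw [Zsqrtd.norm_mul, hw, Zsqrtd.norm_def]
    push_cast
    ring

lemma exists_of_prime_dvd_gaussSphere {p : ℕ} (hp : p.Prime) {n : ℕ} {w z : GaussianInt}
    (hz : p * w = z) (h : z ∈ gaussSphere (p * n)) : p ∣ n ∧ w ∈ gaussSphere (n / p) := by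
  rw [mem_gaussSphere, ← hz, Zsqrtd.norm_mul, Zsqrtd.norm_natCast] at h
  have hp0 : (p : ℤ) ≠ 0 := by exact_mod_cast hp.ne_zero
  push_cast at h
  have h2 : (p : ℤ) * w.norm = n := mul_left_cancel₀ hp0 (by linarith)
  have h3 : (p : ℤ) ∣ n := ⟨_, h2.symm⟩
  refine ⟨by exact_mod_cast h3, ?_⟩
  rw [mem_gaussSphere]
  push_cast
  rw [← h2, Int.mul_ediv_cancel_left _ hp0]

lemma natCast_mul_mem_gaussSphere {p : ℕ} {n : ℕ} (hpn : p ∣ n) {w : GaussianInt}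
    (hw : w ∈ gaussSphere (n / p)) : p * w ∈ gaussSphere (p * n) := by
  rw [mem_gaussSphere] at *
  rw [Zsqrtd.norm_mul, Zsqrtd.norm_natCast, hw]
  obtain ⟨m, rfl⟩ := hpn
  rcases Nat.eq_zero_or_pos p with rfl | h0
  · simp
  · rw [Nat.mul_div_cancel_left _ h0]; push_cast; ring

lemma natCast_gaussianInt_ne_zero {p : ℕ} (hp : p.Prime) : (p : GaussianInt) ≠ 0 := by
  exact_mod_cast hp.ne_zero

lemma ncard_natCast_mul {p : ℕ} (hp : p.Prime) (n : ℕ) :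
    ((({z | (p : GaussianInt) ∣ z} ∩ gaussSphere (p * n)).ncard : ℕ) : ℤ)
      = if p ∣ n then sumTwoSqCount (n / p) else 0 := by
  split_ifs with hpn
  · rw [← ncard_mul_gaussSphere (natCast_gaussianInt_ne_zero hp)]
    congr 2
    ext z
    constructor
    · rintro ⟨⟨w, hw⟩, h2⟩
      exact ⟨w, (exists_of_prime_dvd_gaussSphere hp hw.symm h2).2, hw.symm⟩
    · rintro ⟨w, hw, rfl⟩
      exact ⟨⟨w, rfl⟩, natCast_mul_mem_gaussSphere hpn hw⟩
  · rw [Nat.cast_eq_zero, Set.ncard_eq_zero ((gaussSphere_finite _).inter_of_right _)]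
    refine Set.eq_empty_of_forall_notMem ?_
    rintro z ⟨⟨w, hw⟩, h2⟩
    exact hpn (exists_of_prime_dvd_gaussSphere hp hw.symm h2).1

/-- An inert p divides z z̄, hence z or z̄, hence z; so every element of norm pn is a multiple of p.
-/
lemma sumTwoSqCount_prime_mul_of_three {p : ℕ} (hp : p.Prime) (h3 : p % 4 = 3) (n : ℕ) :
    sumTwoSqCount (p * n) = if p ∣ n then sumTwoSqCount (n / p) else 0 := by
  have := Fact.mk hp
  rw [← ncard_natCast_mul hp, sumTwoSqCount]
  congr 2
  rw [eq_comm, Set.inter_eq_right]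
  intro z hz
  have hpr := GaussianInt.prime_of_nat_prime_of_mod_four_eq_three p h3
  have hd : (p : GaussianInt) ∣ z * star z := by
    rw [← Zsqrtd.norm_eq_mul_conj, mem_gaussSphere.1 hz]
    exact ⟨n, by push_cast; ring⟩
  rcases hpr.dvd_or_dvd hd with h | ⟨w, hw⟩
  · exact h
  · exact ⟨star w, by rw [← star_star z, hw, star_mul]; simp [mul_comm]⟩

/-- Fermat gives p = x² + y², and x + iy is irreducible because its norm is prime. If it divided its
conjugate it would divide 2x; taking norms, p would divide x, which is impossible by size unless x =
0, and then p would be a square. -/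
lemma exists_gaussian_prime {p : ℕ} (hp : p.Prime) (h1 : p % 4 = 1) :
    ∃ π : GaussianInt, Prime π ∧ π * star π = p ∧ ¬ π ∣ star π := by
  have := Fact.mk hp
  obtain ⟨x, y, hxy⟩ := Nat.Prime.sq_add_sq (p := p) (by omega)
  have hn : (⟨x, y⟩ : GaussianInt).norm = p := by
    rw [Zsqrtd.norm_def, ← hxy]; push_cast; ring
  have hmul : (⟨x, y⟩ : GaussianInt) * star ⟨x, y⟩ = p := by
    rw [← Zsqrtd.norm_eq_mul_conj, hn]; simp
  have hirr : Irreducible (⟨x, y⟩ : GaussianInt) := by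
    refine ⟨fun h => ?_, fun u v huv => ?_⟩
    · rw [← Zsqrtd.norm_eq_one_iff, hn] at h
      exact hp.one_lt.ne' (by simpa using h)
    · have h2 : u.norm.natAbs * v.norm.natAbs = p := by
        rw [← Int.natAbs_mul, ← Zsqrtd.norm_mul, ← huv, hn]; simp
      rw [← Zsqrtd.norm_eq_one_iff, ← Zsqrtd.norm_eq_one_iff]
      rcases Nat.Prime.eq_one_or_self_of_dvd hp _ ⟨_, h2.symm⟩ with h | h
      · exact Or.inl h
      · right
        rw [h] at h2
        exact Nat.eq_of_mul_eq_mul_left hp.pos (by omega)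
  refine ⟨⟨x, y⟩, hirr.prime, hmul, ?_⟩
  intro hd
  have h2 : (⟨x, y⟩ : GaussianInt) ∣ ((2 * x : ℕ) : GaussianInt) := by
    have : ((2 * x : ℕ) : GaussianInt) = ⟨x, y⟩ + star ⟨x, y⟩ := by
      ext <;> simp; ring
    rw [this]
    exact dvd_add dvd_rfl hd
  have h4 : (p : ℤ) ∣ ((2 * x : ℕ) : ℤ) * ((2 * x : ℕ) : ℤ) := by
    obtain ⟨w, hw⟩ := h2
    have := congrArg Zsqrtd.norm hw
    rw [Zsqrtd.norm_natCast, Zsqrtd.norm_mul, hn] at this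
    exact ⟨_, this⟩
  have h5 : p ∣ (2 * x) := by
    have : p ∣ (2 * x) * (2 * x) := by exact_mod_cast h4
    exact (hp.dvd_mul.1 this).elim id id
  have h6 : p ∣ x := by
    rcases hp.dvd_mul.1 h5 with h | h
    · exact absurd (Nat.le_of_dvd (by norm_num) h) (by have := hp.two_le; intro h; interval_cases p; omega)
    · exact h
  rcases Nat.eq_zero_or_pos x with rfl | hx
  · have h7 : y ^ 2 = p := by simpa using hxy
    exact absurd (h7 ▸ hp) (Nat.Prime.not_prime_pow le_rfl)
  · have := Nat.le_of_dvd hx h6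
    nlinarith [sq_nonneg y, hp.two_le, Nat.mul_le_mul this this]

/-- Inclusion–exclusion: the elements of norm pn are the multiples by π and by π̄ of those of norm
n, and the overlap consists of the multiples of p because π and π̄ are not associated. -/
lemma sumTwoSqCount_prime_mul_of_one {p : ℕ} (hp : p.Prime) (h1 : p % 4 = 1) (n : ℕ) :
    sumTwoSqCount (p * n) + (if p ∣ n then sumTwoSqCount (n / p) else 0)
      = 2 * sumTwoSqCount n := by
  obtain ⟨π, hπ, hmul, hnd⟩ := exists_gaussian_prime hp h1
  have hπ0 : π ≠ 0 := hπ.ne_zero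
  have hπ0' : star π ≠ 0 := fun h => hnd (h ▸ dvd_zero _)
  have hnorm : π.norm = p := by
    have := Zsqrtd.norm_eq_mul_conj π
    rw [hmul] at this
    exact_mod_cast this
  have hU : gaussSphere (p * n) = ((π * ·) '' gaussSphere n) ∪ ((star π * ·) '' gaussSphere n) := by
    have key : ∀ π' : GaussianInt, π'.norm = p → ∀ w, π' * w ∈ gaussSphere (p * n) ↔
        w ∈ gaussSphere n := by
      intro π' h w
      have hp0 : (p : ℤ) ≠ 0 := by exact_mod_cast hp.ne_zero
      rw [mem_gaussSphere, mem_gaussSphere, Zsqrtd.norm_mul, h]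
      push_cast
      exact mul_right_inj' hp0
    have hnorm' : (star π).norm = p := by rw [Zsqrtd.norm_conj, hnorm]
    ext z
    constructor
    · intro hz
      have hd : π ∣ z * star z := by
        rw [← Zsqrtd.norm_eq_mul_conj, mem_gaussSphere.1 hz]
        exact ⟨star π * n, by rw [← mul_assoc, hmul]; push_cast; ring⟩
      rcases hπ.dvd_or_dvd hd with ⟨w, rfl⟩ | ⟨w, hw⟩
      · exact Or.inl ⟨w, (key _ hnorm w).1 hz, rfl⟩
      · have hz' : z = star π * star w := by
          rw [← star_star z, hw, star_mul, mul_comm]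
        subst hz'
        exact Or.inr ⟨star w, (key _ hnorm' _).1 hz, rfl⟩
    · rintro (⟨w, hw, rfl⟩ | ⟨w, hw, rfl⟩)
      · exact (key _ hnorm w).2 hw
      · exact (key _ hnorm' w).2 hw
  have hI : {z | (p : GaussianInt) ∣ z} ∩ gaussSphere (p * n)
      = ((π * ·) '' gaussSphere n) ∩ ((star π * ·) '' gaussSphere n) := by
    ext z
    constructor
    · rintro ⟨⟨w, hw⟩, hz⟩
      have hmem := exists_of_prime_dvd_gaussSphere hp hw.symm hz
      have hw2 : ∀ π' : GaussianInt, π'.norm = p → π' * w ∈ gaussSphere n := by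
        intro π' h
        rw [mem_gaussSphere, Zsqrtd.norm_mul, h, mem_gaussSphere.1 hmem.2]
        exact_mod_cast Nat.mul_div_cancel' hmem.1
      refine ⟨⟨star π * w, hw2 _ (by rw [Zsqrtd.norm_conj, hnorm]), ?_⟩, ⟨π * w, hw2 _ hnorm, ?_⟩⟩
      · dsimp only; rw [hw, ← hmul, mul_assoc]
      · dsimp only; rw [hw, ← hmul]; ring
    · rintro ⟨⟨u, hu, rfl⟩, ⟨v, hv, hv2⟩⟩
      have hz : π * u ∈ gaussSphere (p * n) := by rw [hU]; exact Or.inl ⟨u, hu, rfl⟩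
      refine ⟨?_, hz⟩
      dsimp only at hv2
      have hd : π ∣ star π * v := ⟨u, hv2⟩
      obtain ⟨w, rfl⟩ := (hπ.dvd_or_dvd hd).resolve_left hnd
      exact ⟨w, by dsimp only; rw [← hv2, ← hmul]; ring⟩
  have hcard := Set.ncard_union_add_ncard_inter ((π * ·) '' gaussSphere n)
    ((star π * ·) '' gaussSphere n) ((gaussSphere_finite n).image _)
    ((gaussSphere_finite n).image _)
  rw [← ncard_natCast_mul hp, hI, two_mul]
  nth_rw 2 [← ncard_mul_gaussSphere hπ0 n]
  rw [← ncard_mul_gaussSphere hπ0' n, sumTwoSqCount, hU]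
  have : ∀ a b c d : ℕ, a + b = c + d → (a : ℤ) + b = d + c := by omega
  exact this _ _ _ _ hcard

/-- `∑_{d ∣ n} χ₄(d)`. -/
def chiDivisorSum (n : ℕ) : ℤ := ∑ d ∈ n.divisors, ZMod.χ₄ (d : ZMod 4)

/-- Inclusion–exclusion again: with D the divisors of n, the divisors of pn are D ∪ pD. For χ₄(p) =
0, 1, -1 this is the recurrence found above for p = 2, split and inert, so induction proves the
two-square theorem. -/
lemma chiDivisorSum_prime_mul {p : ℕ} (hp : p.Prime) {n : ℕ} (hn : n ≠ 0) :
    chiDivisorSum (p * n) + ZMod.χ₄ (p : ZMod 4) * (if p ∣ n then chiDivisorSum (n / p) else 0)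
      = (1 + ZMod.χ₄ (p : ZMod 4)) * chiDivisorSum n := by
  have hpn : p * n ≠ 0 := mul_ne_zero hp.ne_zero hn
  have hinj : Function.Injective (p * ·) := mul_right_injective₀ hp.ne_zero
  have himg : ∀ s : Finset ℕ, ∑ d ∈ s.image (p * ·), ZMod.χ₄ (d : ZMod 4)
      = ZMod.χ₄ (p : ZMod 4) * ∑ d ∈ s, ZMod.χ₄ (d : ZMod 4) := by
    intro s
    rw [Finset.sum_image (fun _ _ _ _ h => hinj h), Finset.mul_sum]
    refine Finset.sum_congr rfl fun d _ => ?_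
    push_cast
    rw [map_mul]
  have hU : (p * n).divisors = n.divisors ∪ n.divisors.image (p * ·) := by
    ext d
    simp only [Nat.mem_divisors, Finset.mem_union, Finset.mem_image]
    constructor
    · rintro ⟨hd, -⟩
      by_cases h : p ∣ d
      · obtain ⟨e, rfl⟩ := h
        exact Or.inr ⟨e, ⟨Nat.dvd_of_mul_dvd_mul_left hp.pos hd, hn⟩, rfl⟩
      · exact Or.inl ⟨(Nat.Coprime.symm ((Nat.Prime.coprime_iff_not_dvd hp).2 h)).dvd_of_dvd_mul_left hd, hn⟩
    · rintro (⟨hd, -⟩ | ⟨e, ⟨hd, -⟩, rfl⟩)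
      · exact ⟨hd.mul_left p, hpn⟩
      · exact ⟨mul_dvd_mul_left p hd, hpn⟩
  have hI : ∑ d ∈ n.divisors ∩ n.divisors.image (p * ·), ZMod.χ₄ (d : ZMod 4)
      = ZMod.χ₄ (p : ZMod 4) * (if p ∣ n then chiDivisorSum (n / p) else 0) := by
    split_ifs with h
    · rw [chiDivisorSum, ← himg]
      congr 1
      obtain ⟨m, rfl⟩ := h
      ext d
      simp only [Nat.mem_divisors, Finset.mem_inter, Finset.mem_image, Nat.mul_div_cancel_left _ hp.pos]
      constructor
      · rintro ⟨⟨hd, -⟩, ⟨e, ⟨he, -⟩, rfl⟩⟩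
        exact ⟨e, ⟨Nat.dvd_of_mul_dvd_mul_left hp.pos hd, right_ne_zero_of_mul hn⟩, rfl⟩
      · rintro ⟨e, ⟨he, -⟩, rfl⟩
        exact ⟨⟨mul_dvd_mul_left p he, hn⟩, ⟨e, ⟨he.mul_left p, hn⟩, rfl⟩⟩
    · rw [mul_zero]
      refine Finset.sum_eq_zero fun d hd => ?_
      simp only [Nat.mem_divisors, Finset.mem_inter, Finset.mem_image] at hd
      obtain ⟨⟨hd, -⟩, ⟨e, -, rfl⟩⟩ := hd
      exact absurd ((dvd_mul_right p e).trans hd) h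
  rw [← hI, chiDivisorSum, hU, Finset.sum_union_inter, himg, chiDivisorSum]
  ring

lemma gaussSphere_zero : gaussSphere 0 = {0} := by
  ext z
  rw [mem_gaussSphere]
  simp [Zsqrtd.norm_eq_zero_iff (show (-1 : ℤ) < 0 by norm_num)]

lemma sumTwoSqCount_one : sumTwoSqCount 1 = 4 := by
  have : gaussSphere 1 = (({⟨1, 0⟩, ⟨-1, 0⟩, ⟨0, 1⟩, ⟨0, -1⟩} : Finset GaussianInt) : Set _) := by
    ext z
    rw [mem_gaussSphere, Zsqrtd.norm_def]
    simp only [Finset.coe_insert, Finset.coe_singleton, Set.mem_insert_iff, Set.mem_singleton_iff,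
      Zsqrtd.ext_iff]
    constructor
    · intro h
      have h1 : z.re ^ 2 + z.im ^ 2 = 1 := by push_cast at h; linarith
      have hr : -1 ≤ z.re ∧ z.re ≤ 1 := by constructor <;> nlinarith [sq_nonneg z.im]
      have hi : -1 ≤ z.im ∧ z.im ≤ 1 := by constructor <;> nlinarith [sq_nonneg z.re]
      obtain ⟨hr1, hr2⟩ := hr
      obtain ⟨hi1, hi2⟩ := hi
      generalize z.re = x at *
      generalize z.im = y at *
      interval_cases x <;> interval_cases y <;> simp_all
    · rintro (⟨h, h'⟩ | ⟨h, h'⟩ | ⟨h, h'⟩ | ⟨h, h'⟩) <;> rw [h, h'] <;> norm_num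
  rw [sumTwoSqCount, this, Set.ncard_coe_finset]
  rfl

/-- **Jacobi's two-square theorem**. -/
theorem sumTwoSqCount_eq {n : ℕ} (hn : n ≠ 0) : sumTwoSqCount n = 4 * chiDivisorSum n := by
  induction n using Nat.strong_induction_on with
  | _ n ih =>
    rcases eq_or_ne n 1 with rfl | h1
    · rw [sumTwoSqCount_one]; simp [chiDivisorSum]
    obtain ⟨p, hp, m, rfl⟩ := Nat.exists_prime_and_dvd h1
    have hm : m ≠ 0 := right_ne_zero_of_mul hn
    have hlt : m < p * m := by nlinarith [hp.two_le, Nat.pos_of_ne_zero hm]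
    have ihm := ih m hlt hm
    have ihd : (if p ∣ m then sumTwoSqCount (m / p) else 0)
        = 4 * (if p ∣ m then chiDivisorSum (m / p) else 0) := by
      split_ifs with h
      · exact ih _ ((Nat.div_le_self _ _).trans_lt hlt)
          (Nat.div_pos (Nat.le_of_dvd (Nat.pos_of_ne_zero hm) h) hp.pos).ne'
      · rfl
    have hρ := chiDivisorSum_prime_mul hp hm
    rcases hp.eq_two_or_odd with rfl | hodd
    · have hχ : ZMod.χ₄ ((2 : ℕ) : ZMod 4) = 0 := by rfl
      rw [hχ] at hρ
      rw [sumTwoSqCount_two_mul, ihm]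
      linarith
    · have hmod : p % 4 = 1 ∨ p % 4 = 3 := by omega
      rcases hmod with h | h
      · have hχ : ZMod.χ₄ (p : ZMod 4) = 1 := ZMod.χ₄_nat_one_mod_four h
        rw [hχ] at hρ
        have := sumTwoSqCount_prime_mul_of_one hp h m
        rw [ihd, ihm] at this
        linarith
      · have hχ : ZMod.χ₄ (p : ZMod 4) = -1 := ZMod.χ₄_nat_three_mod_four h
        rw [hχ] at hρ
        rw [sumTwoSqCount_prime_mul_of_three hp h, ihd]
        linarith

/-! ### Gauss's product for the theta series -/

/-- The Gaussian binomial coefficient. -/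
def qBinom {R : Type*} [CommRing R] (Q : R) : ℕ → ℕ → R
  | _, 0 => 1
  | 0, _ + 1 => 0
  | N + 1, k + 1 => qBinom Q N k + Q ^ (k + 1) * qBinom Q N (k + 1)

lemma qBinom_zero_right {R : Type*} [CommRing R] (Q : R) (N : ℕ) : qBinom Q N 0 = 1 := by
  cases N <;> rfl

lemma qBinom_eq_zero {R : Type*} [CommRing R] (Q : R) {N k : ℕ} (h : N < k) :
    qBinom Q N k = 0 := by
  induction N generalizing k with
  | zero => obtain ⟨k, rfl⟩ := Nat.exists_eq_succ_of_ne_zero h.ne'; rfl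
  | succ N ih =>
    obtain ⟨k, rfl⟩ := Nat.exists_eq_succ_of_ne_zero (Nat.ne_zero_of_lt h)
    rw [qBinom, ih (by omega), ih (by omega)]
    simp

/-- The `q`-binomial theorem. -/
lemma prod_one_add_mul_pow {R : Type*} [CommRing R] (Q x : R) (N : ℕ) :
    ∏ k ∈ Finset.range N, (1 + x * Q ^ k)
      = ∑ k ∈ Finset.range (N + 1), qBinom Q N k * Q ^ (k.choose 2) * x ^ k := by
  induction N generalizing x with
  | zero => simp [qBinom]
  | succ N ih =>
    rw [Finset.prod_range_succ']
    -- With the factor k = 0 split off, the rest is the product for xQ; the powers of Q this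
    -- produces are those of the Pascal rule defining `qBinom`.
    have h1 : ∀ k, 1 + x * Q ^ (k + 1) = 1 + (x * Q) * Q ^ k := fun k => by ring
    simp_rw [h1]
    rw [ih (x * Q), Finset.sum_range_succ' _ (N + 1), pow_zero, mul_one, mul_add, mul_one]
    have h2 : ∀ k, qBinom Q (N + 1) (k + 1) * Q ^ ((k + 1).choose 2) * x ^ (k + 1)
        = qBinom Q N k * Q ^ (k.choose 2) * (x * Q) ^ k * x
          + qBinom Q N (k + 1) * Q ^ ((k + 1).choose 2) * (x * Q) ^ (k + 1) := by
      intro k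
      rw [qBinom, Nat.choose_succ_succ' k 1, Nat.choose_one_right]
      ring
    simp_rw [h2]
    rw [Finset.sum_add_distrib, ← Finset.sum_mul]
    have h3 := Finset.sum_range_succ' (fun k => qBinom Q N k * Q ^ (k.choose 2) * (x * Q) ^ k) (N + 1)
    rw [Finset.sum_range_succ, qBinom_eq_zero Q (Nat.lt_succ_self N)] at h3
    simp only [qBinom_zero_right] at h3 ⊢
    linear_combination h3

/-- `∏_{k = 1}^N (1 - Q^k)`. -/
def qFac {R : Type*} [CommRing R] (Q : R) (N : ℕ) : R := ∏ k ∈ Finset.range N, (1 - Q ^ (k + 1))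

lemma qFac_succ {R : Type*} [CommRing R] (Q : R) (N : ℕ) :
    qFac Q (N + 1) = qFac Q N * (1 - Q ^ (N + 1)) := Finset.prod_range_succ _ _

/-- The factorial formula without division, by induction on i + j: the two Pascal terms combine
through 1 - Q^(i+j) = (1 - Q^i) + Q^i (1 - Q^j). -/
lemma qBinom_mul_qFac {R : Type*} [CommRing R] (Q : R) (i j : ℕ) :
    qBinom Q (i + j) i * qFac Q i * qFac Q j = qFac Q (i + j) := by
  induction h : i + j generalizing i j with
  | zero =>
    obtain ⟨rfl, rfl⟩ : i = 0 ∧ j = 0 := by omega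
    simp [qFac, qBinom]
  | succ N ih =>
    cases i with
    | zero =>
      obtain rfl : j = N + 1 := by omega
      simp [qFac, qBinom]
    | succ i =>
      have h1 := ih i j (by omega)
      rw [qBinom, qFac_succ]
      cases j with
      | zero =>
        obtain rfl : i = N := by omega
        rw [qBinom_eq_zero Q (Nat.lt_succ_self i), qFac_succ]
        linear_combination (1 - Q ^ (i + 1)) * h1
      | succ j =>
        have h2 := ih (i + 1) j (by omega)
        rw [qFac_succ] at h2
        obtain rfl : N = i + j + 1 := by omega
        rw [qFac_succ Q (i + j + 1)]
        have h3 : qFac Q (j + 1) = qFac Q j * (1 - Q ^ (j + 1)) := qFac_succ _ _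
        rw [h3] at h1 ⊢
        have h4 : Q ^ (i + j + 1 + 1) = Q ^ (i + 1) * Q ^ (j + 1) := by rw [← pow_add]; ring_nf
        rw [h4]
        linear_combination (1 - Q ^ (i + 1)) * h1 + Q ^ (i + 1) * (1 - Q ^ (j + 1)) * h2

/-! ### Infinite products on the unit disc. -/

lemma norm_pow_succ_lt_one {q : ℂ} (hq : ‖q‖ < 1) (n : ℕ) : ‖q ^ (n + 1)‖ < 1 := by
  rw [norm_pow]
  exact pow_lt_one₀ (norm_nonneg _) hq n.succ_ne_zero

lemma one_sub_pow_succ_ne_zero {q : ℂ} (hq : ‖q‖ < 1) (n : ℕ) : 1 - q ^ (n + 1) ≠ 0 := by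
  intro h
  have h2 := norm_pow_succ_lt_one hq n
  rw [← sub_eq_zero.1 h, norm_one] at h2
  exact lt_irrefl _ h2

lemma one_add_pow_succ_ne_zero {q : ℂ} (hq : ‖q‖ < 1) (n : ℕ) : 1 + q ^ (n + 1) ≠ 0 := by
  intro h
  have h2 := norm_pow_succ_lt_one hq n
  rw [eq_neg_of_add_eq_zero_right h, norm_neg, norm_one] at h2
  exact lt_irrefl _ h2

lemma qFac_ne_zero {q : ℂ} (hq : ‖q‖ < 1) (n : ℕ) : qFac q n ≠ 0 :=
  Finset.prod_ne_zero_iff.2 fun k _ => one_sub_pow_succ_ne_zero hq k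

/-- Euler's product `∏_{k ≥ 1} (1 - q^k)`. -/
def eulerProd (q : ℂ) : ℂ := ∏' n : ℕ, (1 - q ^ (n + 1))

lemma tendsto_qFac {q : ℂ} (hq : ‖q‖ < 1) : Tendsto (qFac q) atTop (𝓝 (eulerProd q)) :=
  (ModularForm.multipliable_one_sub_pow hq).hasProd.tendsto_prod_nat

lemma eulerProd_ne_zero {q : ℂ} (hq : ‖q‖ < 1) : eulerProd q ≠ 0 := by
  refine tprod_one_add_ne_zero_of_summable (f := fun n ↦ -q ^ (n + 1)) ?_ ?_
  · intro i
    simpa [sub_eq_add_neg] using one_sub_pow_succ_ne_zero hq i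
  · simpa using (summable_nat_add_iff 1).mpr (summable_geometric_of_lt_one (norm_nonneg _) hq)

lemma norm_sq_lt_one {q : ℂ} (hq : ‖q‖ < 1) : ‖q ^ 2‖ < 1 := norm_pow_succ_lt_one hq 1

/-- The alternating theta series `∑_{n ∈ ℤ} (-1)^n q^(n^2)`. -/
def altTheta (q : ℂ) : ℂ := ∑' n : ℤ, (-1) ^ n.natAbs * q ^ (n.natAbs ^ 2)

lemma qFac_two_mul {R : Type*} [CommRing R] (q : R) (n : ℕ) :
    qFac q (2 * n) = qFac (q ^ 2) n * ∏ k ∈ Finset.range n, (1 - q ^ (2 * k + 1)) := by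
  induction n with
  | zero => simp [qFac]
  | succ n ih =>
    rw [show 2 * (n + 1) = 2 * n + 1 + 1 by ring, qFac_succ, qFac_succ, ih, qFac_succ,
      Finset.prod_range_succ]
    ring

/-- A finite form of Gauss's product. -/
lemma sum_qBinom_eq {q : ℂ} (hq : q ≠ 0) (n : ℕ) :
    ∑ k ∈ Finset.range (2 * n + 1), qBinom (q ^ 2) (2 * n) k * ((-1) ^ ((k : ℤ) - n).natAbs *
        q ^ (((k : ℤ) - n).natAbs ^ 2))
      = (∏ k ∈ Finset.range n, (1 - q ^ (2 * k + 1))) ^ 2 := by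
  -- This x makes the factors 1 - q^e with e running through the odd numbers from -(2n-1) to 2n-1.
  -- Reflecting the negative half gives the square of a product, up to the sign (-1)^n and the power
  -- q^(-n²).
  have key := prod_one_add_mul_pow (q ^ 2) (-q * (q ^ (2 * n))⁻¹) (2 * n)
  have hL : q ^ (n ^ 2) * ∏ k ∈ Finset.range (2 * n), (1 + -q * (q ^ (2 * n))⁻¹ * (q ^ 2) ^ k)
      = (-1) ^ n * (∏ k ∈ Finset.range n, (1 - q ^ (2 * k + 1))) ^ 2 := by
    rw [two_mul n, Finset.prod_range_add, ← two_mul, ← Finset.prod_range_reflect]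
    have h1 : ∀ k ∈ Finset.range n, 1 + -q * (q ^ (2 * n))⁻¹ * (q ^ 2) ^ (n - 1 - k)
        = (-1) * (q ^ (2 * k + 1))⁻¹ * (1 - q ^ (2 * k + 1)) := by
      intro k hk
      rw [Finset.mem_range] at hk
      have : q ^ (2 * n) = q * (q ^ 2) ^ (n - 1 - k) * q ^ (2 * k + 1) := by
        rw [← pow_mul, ← pow_succ', ← pow_add]; congr 1; omega
      rw [this]
      field_simp
      ring
    have h2 : ∀ k, 1 + -q * (q ^ (2 * n))⁻¹ * (q ^ 2) ^ (n + k) = 1 - q ^ (2 * k + 1) := by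
      intro k
      have : (q ^ 2) ^ (n + k) * q = q ^ (2 * k + 1) * q ^ (2 * n) := by
        rw [← pow_mul, ← pow_add, ← pow_succ]; congr 1; ring
      field_simp
      linear_combination -this
    have h3 : q ^ (n ^ 2) * ∏ k ∈ Finset.range n, (q ^ (2 * k + 1))⁻¹ = 1 := by
      have h4 : ∏ k ∈ Finset.range n, (q ^ (2 * k + 1)) = q ^ (n ^ 2) := by
        rw [Finset.prod_pow_eq_pow_sum]
        congr 1
        clear key h1 h2
        induction n with
        | zero => rfl
        | succ n ih => rw [Finset.sum_range_succ, ih]; ring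
      rw [Finset.prod_inv_distrib, h4]
      exact mul_inv_cancel₀ (pow_ne_zero _ hq)
    rw [Finset.prod_congr rfl h1, Finset.prod_congr rfl fun k _ => h2 k, Finset.prod_mul_distrib,
      Finset.prod_mul_distrib, Finset.prod_const, Finset.card_range]
    linear_combination (-1) ^ n * (∏ k ∈ Finset.range n, (1 - q ^ (2 * k + 1))) ^ 2 * h3
  -- Completing the square: 2·C(k,2) + k = k², so the exponent is n² + k² - 2nk = (k - n)².
  have hR : ∀ k : ℕ, (-1) ^ n * (q ^ (n ^ 2) * ((q ^ 2) ^ (k.choose 2) * (-q * (q ^ (2 * n))⁻¹) ^ k))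
      = (-1) ^ ((k : ℤ) - n).natAbs * q ^ (((k : ℤ) - n).natAbs ^ 2) := by
    intro k
    have h1 : (-1 : ℂ) ^ ((k : ℤ) - n).natAbs = (-1) ^ n * (-1) ^ k := by
      rw [← pow_add]
      apply neg_one_pow_congr
      rw [Int.natAbs_even, Int.even_sub, Nat.even_add, Int.even_coe_nat, Int.even_coe_nat]
      tauto
    have h2 : q ^ (((k : ℤ) - n).natAbs ^ 2) * q ^ (2 * n * k) = q ^ (n ^ 2) * q ^ (2 * k.choose 2 + k) := by
      rw [← pow_add, ← pow_add]
      congr 1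
      zify
      rw [sq_abs]
      have : (k.choose 2 : ℤ) * 2 + k = k ^ 2 := by
        have h5 := Nat.triangle_succ k
        rw [Nat.choose_two_right]
        have h6 : k * (k - 1) / 2 * 2 = k * (k - 1) :=
          Nat.div_mul_cancel (even_iff_two_dvd.1 (Nat.even_mul_pred_self k))
        have h7 : k * (k - 1) + k = k ^ 2 := by cases k <;> simp; ring
        exact_mod_cast (by rw [h6, h7])
      linear_combination -this
    have h3 : q ^ (2 * n * k) ≠ 0 := pow_ne_zero _ hq
    have h4 : q ^ (((k : ℤ) - n).natAbs ^ 2)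
        = q ^ (n ^ 2) * q ^ (2 * k.choose 2 + k) * (q ^ (2 * n * k))⁻¹ := by
      rw [← h2, mul_inv_cancel_right₀ h3]
    rw [h1, h4, mul_pow, inv_pow, ← pow_mul, ← pow_mul, neg_pow q k, pow_add]
    ring
  have hneg : ((-1 : ℂ) ^ n) * (-1) ^ n = 1 := by rw [← mul_pow]; norm_num
  calc _ = (-1) ^ n * (q ^ (n ^ 2) * ∑ k ∈ Finset.range (2 * n + 1), qBinom (q ^ 2) (2 * n) k *
          (q ^ 2) ^ (k.choose 2) * (-q * (q ^ (2 * n))⁻¹) ^ k) := by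
        rw [Finset.mul_sum, Finset.mul_sum]
        refine Finset.sum_congr rfl fun k _ => ?_
        rw [← hR]; ring
    _ = _ := by
        rw [← key, hL, ← mul_assoc, hneg, one_mul]

lemma summable_pow_natAbs_sq {r : ℝ} (h0 : 0 ≤ r) (h1 : r < 1) :
    Summable fun n : ℤ => r ^ (n.natAbs ^ 2) := by
  have h : Summable fun n : ℕ => r ^ (n ^ 2) :=
    Summable.of_nonneg_of_le (fun n => by positivity)
      (fun n => pow_le_pow_of_le_one h0 h1.le (Nat.le_self_pow two_ne_zero n))
      (summable_geometric_of_lt_one h0 h1)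
  exact Summable.of_nat_of_neg (by simpa using h) (by simpa using h)

lemma altTheta_zero : altTheta 0 = 1 := by
  rw [altTheta, tsum_eq_single 0]
  · simp
  · intro n hn
    simp [hn]

/-- **Gauss's product** for the alternating theta series. -/
theorem altTheta_eq {q : ℂ} (hq : ‖q‖ < 1) :
    altTheta q = eulerProd q ^ 2 / eulerProd (q ^ 2) := by
  rcases eq_or_ne q 0 with rfl | hq0
  · simp [altTheta_zero, eulerProd]
  have hQ : ‖q ^ 2‖ < 1 := norm_sq_lt_one hq
  set Q := q ^ 2 with hQdef
  have hPQ := eulerProd_ne_zero hQ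
  have hlim := tendsto_qFac hQ
  have hliminv : Tendsto (fun n => (qFac Q n)⁻¹) atTop (𝓝 (eulerProd Q)⁻¹) := hlim.inv₀ hPQ
  obtain ⟨C₁, hC₁⟩ := (Metric.isBounded_range_of_tendsto _ hlim).exists_norm_le
  obtain ⟨C₂, hC₂⟩ := (Metric.isBounded_range_of_tendsto _ hliminv).exists_norm_le
  have hC₁' : ∀ n, ‖qFac Q n‖ ≤ C₁ := fun n => hC₁ _ ⟨n, rfl⟩
  have hC₂' : ∀ n, ‖(qFac Q n)⁻¹‖ ≤ C₂ := fun n => hC₂ _ ⟨n, rfl⟩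
  have hC₁0 : 0 ≤ C₁ := (norm_nonneg _).trans (hC₁' 0)
  have hC₂0 : 0 ≤ C₂ := (norm_nonneg _).trans (hC₂' 0)
  -- The summand of the finite identity with index k = n + j and the Gaussian binomial written
  -- through factorials. Each coefficient tends to 1/∏(1 - Q^k), and the factorials and their
  -- inverses are bounded, so dominated convergence applies.
  let F : ℕ → ℤ → ℂ := fun n j => if j ∈ Finset.Icc (-(n : ℤ)) n then
    qFac Q (2 * n) * (qFac Q (n + j).toNat)⁻¹ * (qFac Q (n - j).toNat)⁻¹ *
      ((-1) ^ j.natAbs * q ^ (j.natAbs ^ 2)) else 0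
  have hsumF : ∀ n, ∑' j, F n j = (qFac q (2 * n) / qFac Q n) ^ 2 := by
    intro n
    rw [tsum_eq_sum (s := Finset.Icc (-(n : ℤ)) n) (fun j hj => if_neg hj)]
    rw [qFac_two_mul q n, mul_div_cancel_left₀ _ (qFac_ne_zero hQ n), ← sum_qBinom_eq hq0]
    refine Finset.sum_nbij' (fun j => (n + j).toNat) (fun k => (k : ℤ) - n) ?_ ?_ ?_ ?_ ?_
    · intro j hj; rw [Finset.mem_Icc] at hj; rw [Finset.mem_range]; omega
    · intro k hk; rw [Finset.mem_range] at hk; rw [Finset.mem_Icc]; omega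
    · intro j hj; rw [Finset.mem_Icc] at hj; omega
    · intro k hk; omega
    · intro j hj
      have hj' := Finset.mem_Icc.1 hj
      simp only [if_pos hj]
      have h1 : (((n + j).toNat : ℕ) : ℤ) - n = j := by omega
      have h2 := qBinom_mul_qFac Q (n + j).toNat (n - j).toNat
      have h3 : (n + j).toNat + (n - j).toNat = 2 * n := by omega
      rw [h3] at h2
      rw [h1, ← h2]
      have := qFac_ne_zero hQ (n + j).toNat
      have := qFac_ne_zero hQ (n - j).toNat
      field_simp
      rfl
  have hT1 : Tendsto (fun n => ∑' j, F n j) atTop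
      (𝓝 (∑' j : ℤ, (eulerProd Q)⁻¹ * ((-1) ^ j.natAbs * q ^ (j.natAbs ^ 2)))) := by
    refine tendsto_tsum_of_dominated_convergence
      (bound := fun j : ℤ => C₁ * C₂ * C₂ * ‖q‖ ^ (j.natAbs ^ 2))
      ((summable_pow_natAbs_sq (norm_nonneg q) hq).mul_left _) ?_ ?_
    · intro j
      have h2n : Tendsto (fun n : ℕ => 2 * n) atTop atTop :=
        tendsto_id.const_mul_atTop' (by norm_num)
      have hp : Tendsto (fun n : ℕ => (n + j).toNat) atTop atTop :=
        tendsto_atTop.2 fun b => by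
          filter_upwards [eventually_ge_atTop (b + j.natAbs)] with n hn; omega
      have hm : Tendsto (fun n : ℕ => (n - j).toNat) atTop atTop :=
        tendsto_atTop.2 fun b => by
          filter_upwards [eventually_ge_atTop (b + j.natAbs)] with n hn; omega
      have := (((hlim.comp h2n).mul (hliminv.comp hp)).mul (hliminv.comp hm)).mul_const
        ((-1) ^ j.natAbs * q ^ (j.natAbs ^ 2))
      rw [mul_inv_cancel₀ hPQ, one_mul] at this
      refine this.congr' ?_
      filter_upwards [eventually_ge_atTop j.natAbs] with n hn
      have : j ∈ Finset.Icc (-(n : ℤ)) n := by rw [Finset.mem_Icc]; omega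
      simp only [F, if_pos this, Function.comp]
    · refine Eventually.of_forall fun n j => ?_
      simp only [F]
      split_ifs
      · rw [norm_mul, norm_mul, norm_mul, norm_mul, norm_pow, norm_neg, norm_one, one_pow, one_mul,
          norm_pow]
        gcongr
        exacts [hC₁' _, hC₂' _, hC₂' _]
      · rw [norm_zero]; positivity
  have hT2 : Tendsto (fun n => (qFac q (2 * n) / qFac Q n) ^ 2) atTop
      (𝓝 ((eulerProd q / eulerProd Q) ^ 2)) :=
    (((tendsto_qFac hq).comp (tendsto_id.const_mul_atTop' (by norm_num : 0 < 2))).div hlim hPQ).pow 2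
  have := tendsto_nhds_unique hT1 (hT2.congr fun n => (hsumF n).symm)
  rw [tsum_mul_left] at this
  rw [altTheta]
  field_simp at this ⊢
  exact this

lemma altTheta_ne_zero {q : ℂ} (hq : ‖q‖ < 1) : altTheta q ≠ 0 := by
  rw [altTheta_eq hq]
  exact div_ne_zero (pow_ne_zero _ (eulerProd_ne_zero hq)) (eulerProd_ne_zero (norm_sq_lt_one hq))

/-- Since 1 - q^(2k) = (1 - q^k)(1 + q^k), Gauss's product has factors (1 - q^k)/(1 + q^k), whose
moduli can be compared one at a time. -/
lemma tendsto_altTheta {q : ℂ} (hq : ‖q‖ < 1) :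
    Tendsto (fun N => ∏ k ∈ Finset.range N, ((1 - q ^ (k + 1)) / (1 + q ^ (k + 1)))) atTop
      (𝓝 (altTheta q)) := by
  rw [altTheta_eq hq]
  refine (((tendsto_qFac hq).pow 2).div (tendsto_qFac (norm_sq_lt_one hq))
    (eulerProd_ne_zero (norm_sq_lt_one hq))).congr fun N => ?_
  simp only [Pi.div_apply]
  rw [qFac, qFac, ← Finset.prod_pow, ← Finset.prod_div_distrib]
  refine Finset.prod_congr rfl fun k _ => ?_
  have h1 := one_sub_pow_succ_ne_zero hq k
  have h2 := one_add_pow_succ_ne_zero hq k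
  have h3 : 1 - (q ^ 2) ^ (k + 1) = (1 - q ^ (k + 1)) * (1 + q ^ (k + 1)) := by ring
  rw [h3]
  field_simp

/-- On |q| = r each factor has modulus at least (1 - r^k)/(1 + r^k). This is the lower bound for the
denominator θ₃² in Cauchy's estimate. -/
lemma norm_altTheta_ge {q : ℂ} (hq : ‖q‖ < 1) : ‖altTheta ‖q‖‖ ≤ ‖altTheta q‖ := by
  have hq' : ‖((‖q‖ : ℝ) : ℂ)‖ < 1 := by simpa using hq
  refine le_of_tendsto_of_tendsto' (tendsto_altTheta hq').norm (tendsto_altTheta hq).norm fun N => ?_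
  rw [norm_prod, norm_prod]
  refine Finset.prod_le_prod (fun _ _ => norm_nonneg _) fun k _ => ?_
  have h1 := norm_pow_succ_lt_one hq k
  rw [norm_div, norm_div]
  have e1 : ‖1 - ((‖q‖ : ℝ) : ℂ) ^ (k + 1)‖ = 1 - ‖q ^ (k + 1)‖ := by
    rw [norm_pow, ← Complex.ofReal_pow, ← Complex.ofReal_one, ← Complex.ofReal_sub,
      Complex.norm_real, Real.norm_of_nonneg]
    rw [norm_pow] at h1; linarith
  have e2 : ‖1 + ((‖q‖ : ℝ) : ℂ) ^ (k + 1)‖ = 1 + ‖q ^ (k + 1)‖ := by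
    rw [norm_pow, ← Complex.ofReal_pow, ← Complex.ofReal_one, ← Complex.ofReal_add,
      Complex.norm_real, Real.norm_of_nonneg]
    positivity
  rw [e1, e2]
  have f1 : 1 - ‖q ^ (k + 1)‖ ≤ ‖1 - q ^ (k + 1)‖ := by
    simpa using norm_sub_norm_le (1 : ℂ) (q ^ (k + 1))
  have f2 : ‖1 + q ^ (k + 1)‖ ≤ 1 + ‖q ^ (k + 1)‖ := by
    simpa using norm_add_le (1 : ℂ) (q ^ (k + 1))
  have f3 : 0 < ‖1 + q ^ (k + 1)‖ := norm_pos_iff.2 (one_add_pow_succ_ne_zero hq k)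
  gcongr

lemma norm_altTheta_le_one {r : ℝ} (h0 : 0 ≤ r) (h1 : r < 1) : ‖altTheta r‖ ≤ 1 := by
  have hq' : ‖(r : ℂ)‖ < 1 := by simpa [abs_of_nonneg h0] using h1
  refine le_of_tendsto' (tendsto_altTheta hq').norm fun N => ?_
  rw [norm_prod]
  refine Finset.prod_le_one (fun _ _ => norm_nonneg _) fun k _ => ?_
  have h2 : r ^ (k + 1) < 1 := pow_lt_one₀ h0 h1 k.succ_ne_zero
  have h3 : 0 ≤ r ^ (k + 1) := by positivity
  have e : (1 - (r : ℂ) ^ (k + 1)) / (1 + (r : ℂ) ^ (k + 1))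
      = (((1 - r ^ (k + 1)) / (1 + r ^ (k + 1)) : ℝ) : ℂ) := by push_cast; rfl
  rw [e, Complex.norm_real, Real.norm_of_nonneg (div_nonneg (by linarith) (by linarith)),
    div_le_one (by linarith)]
  linarith

/-! ### Theta functions on the positive axis -/

lemma hasSum_theta3 {y : ℝ} (hy : 0 < y) :
    HasSum (fun n : ℤ => Real.exp (-Real.pi * y * (n : ℝ) ^ 2)) (theta3 y) := by
  have h := HurwitzZeta.hasSum_int_evenKernel 0 hy
  refine Summable.hasSum (h.summable.congr fun n => ?_)
  congr 1; ring

lemma theta3_eq_kernel {y : ℝ} (hy : 0 < y) : theta3 y = HurwitzZeta.evenKernel 0 y := by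
  have h := HurwitzZeta.hasSum_int_evenKernel 0 hy
  refine (hasSum_theta3 hy).unique ?_
  rw [← QuotientAddGroup.mk_zero, ]
  refine h.congr_fun fun n => ?_
  congr 1; ring

lemma hasSum_theta2 {y : ℝ} (hy : 0 < y) :
    HasSum (fun n : ℤ => Real.exp (-Real.pi * y * ((n : ℝ) - 1 / 2) ^ 2)) (theta2 y) := by
  have h := HurwitzZeta.hasSum_int_evenKernel (-(1 / 2)) hy
  refine Summable.hasSum (h.summable.congr fun n => ?_)
  congr 1; ring

lemma theta2_eq_kernel {y : ℝ} (hy : 0 < y) :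
    theta2 y = HurwitzZeta.evenKernel ((1 / 2 : ℝ) : UnitAddCircle) y := by
  have h := HurwitzZeta.hasSum_int_evenKernel (-(1 / 2)) hy
  rw [QuotientAddGroup.mk_neg, HurwitzZeta.evenKernel_neg] at h
  refine (hasSum_theta2 hy).unique (h.congr_fun fun n => ?_)
  congr 1; ring

lemma hasSum_theta2' {y : ℝ} (hy : 0 < y) :
    HasSum (fun n : ℤ => Real.exp (-Real.pi * y * ((n : ℝ) + 1 / 2) ^ 2)) (theta2 y) := by
  rw [theta2_eq_kernel hy]
  refine (HurwitzZeta.hasSum_int_evenKernel (1 / 2) hy).congr_fun fun n => ?_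
  congr 1; ring

lemma summable_norm_theta4 {y : ℝ} (hy : 0 < y) :
    Summable (fun n : ℤ => ‖(-1 : ℝ) ^ n * Real.exp (-Real.pi * y * (n : ℝ) ^ 2)‖) := by
  refine (hasSum_theta3 hy).summable.congr fun n => ?_
  rw [norm_mul, norm_zpow, norm_neg, norm_one, one_zpow, one_mul,
    Real.norm_of_nonneg (Real.exp_pos _).le]

lemma hasSum_theta4 {y : ℝ} (hy : 0 < y) :
    HasSum (fun n : ℤ => (-1 : ℝ) ^ n * Real.exp (-Real.pi * y * (n : ℝ) ^ 2)) (theta4 y) :=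
  (summable_norm_theta4 hy).of_norm.hasSum

lemma theta4_eq_kernel {y : ℝ} (hy : 0 < y) :
    theta4 y = HurwitzZeta.cosKernel ((1 / 2 : ℝ) : UnitAddCircle) y := by
  have h := HurwitzZeta.hasSum_int_cosKernel (1 / 2) hy
  have h2 := Complex.hasSum_ofReal.2 (hasSum_theta4 hy)
  refine Complex.ofReal_injective (h2.unique (h.congr_fun fun n => ?_))
  have e : Complex.exp (2 * Real.pi * Complex.I * ((1 / 2 : ℝ) : ℂ) * n) = (-1) ^ n := by
    rw [← Complex.exp_pi_mul_I, ← Complex.exp_int_mul]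
    congr 1; push_cast; ring
  rw [e]
  push_cast
  congr 2
  ring

lemma theta3_pos {y : ℝ} (hy : 0 < y) : 0 < theta3 y :=
  (hasSum_theta3 hy).summable.tsum_pos (fun _ => (Real.exp_pos _).le) 0 (Real.exp_pos _)

lemma theta2_ge {y : ℝ} (hy : 0 < y) : Real.exp (-Real.pi * y / 4) ≤ theta2 y := by
  have := le_hasSum (hasSum_theta2 hy) 0 fun n _ => (Real.exp_pos _).le
  refine le_trans (le_of_eq ?_) this
  congr 1; push_cast; ring

lemma theta2_pos {y : ℝ} (hy : 0 < y) : 0 < theta2 y := (Real.exp_pos _).trans_le (theta2_ge hy)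

lemma theta3_inv {y : ℝ} (hy : 0 < y) : theta3 (1 / y) = Real.sqrt y * theta3 y := by
  rw [theta3_eq_kernel hy, theta3_eq_kernel (one_div_pos.2 hy),
    HurwitzZeta.evenKernel_functional_equation 0 y, ← HurwitzZeta.evenKernel_eq_cosKernel_of_zero,
    Real.sqrt_eq_rpow, ← mul_assoc, mul_one_div_cancel (Real.rpow_pos_of_pos hy _).ne', one_mul]

/-- Poisson summation turns the shift by 1/2 into the character (-1)^n, so inversion exchanges θ₂
and θ₄. -/
lemma theta4_inv {y : ℝ} (hy : 0 < y) : theta4 (1 / y) = Real.sqrt y * theta2 y := by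
  rw [theta2_eq_kernel hy, theta4_eq_kernel (one_div_pos.2 hy),
    HurwitzZeta.evenKernel_functional_equation _ y,
    Real.sqrt_eq_rpow, ← mul_assoc, mul_one_div_cancel (Real.rpow_pos_of_pos hy _).ne', one_mul]

lemma theta4_pos {y : ℝ} (hy : 0 < y) : 0 < theta4 y := by
  have := theta4_inv (one_div_pos.2 hy)
  rw [one_div_one_div] at this
  rw [this]
  exact mul_pos (Real.sqrt_pos.2 (one_div_pos.2 hy)) (theta2_pos (one_div_pos.2 hy))

lemma theta2_inv {y : ℝ} (hy : 0 < y) : theta2 (1 / y) = Real.sqrt y * theta4 y := by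
  have := theta4_inv (one_div_pos.2 hy)
  rw [one_div_one_div] at this
  rw [this, ← mul_assoc, ← Real.sqrt_mul hy.le, mul_one_div_cancel hy.ne', Real.sqrt_one, one_mul]

/-- Splits ℤ² by the parity of the coordinate sum. On either class the rotated coordinates turn the
sum of squares into twice a sum of squares (shifted by halves on the odd class), which is the source
of the duplication formulas. -/
lemma hasSum_int_prod_parity {F : ℤ × ℤ → ℝ} {A B : ℝ}
    (h1 : HasSum (fun p : ℤ × ℤ => F (p.1 + p.2, p.1 - p.2)) A)
    (h2 : HasSum (fun p : ℤ × ℤ => F (p.1 + p.2, p.1 - p.2 + 1)) B) : HasSum F (A + B) := by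
  let g₁ : ℤ × ℤ → ℤ × ℤ := fun p => (p.1 + p.2, p.1 - p.2)
  let g₂ : ℤ × ℤ → ℤ × ℤ := fun p => (p.1 + p.2, p.1 - p.2 + 1)
  have i1 : Function.Injective g₁ := by
    rintro ⟨a, b⟩ ⟨c, d⟩ h
    simp only [g₁, Prod.mk.injEq] at h ⊢
    omega
  have i2 : Function.Injective g₂ := by
    rintro ⟨a, b⟩ ⟨c, d⟩ h
    simp only [g₂, Prod.mk.injEq] at h ⊢
    omega
  have hc : IsCompl (range g₁) (range g₂) := by
    refine ⟨Set.disjoint_left.2 ?_, codisjoint_iff.2 (Set.eq_univ_of_forall ?_)⟩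
    · rintro _ ⟨⟨a, b⟩, rfl⟩ ⟨⟨c, d⟩, h⟩
      simp only [g₁, g₂, Prod.mk.injEq] at h
      omega
    · rintro ⟨m, n⟩
      rcases Int.even_or_odd' (m + n) with ⟨k, hk | hk⟩
      · exact Or.inl ⟨(k, m - k), by simp only [g₁, Prod.mk.injEq]; omega⟩
      · exact Or.inr ⟨(k, m - k), by simp only [g₂, Prod.mk.injEq]; omega⟩
  exact HasSum.add_isCompl hc (i1.hasSum_range_iff.2 h1) (i2.hasSum_range_iff.2 h2)

lemma hasSum_mul_of_norm {f g : ℤ → ℝ} {A B : ℝ} (hf : HasSum f A) (hg : HasSum g B)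
    (hf' : Summable fun n => ‖f n‖) (hg' : Summable fun n => ‖g n‖) :
    HasSum (fun p : ℤ × ℤ => f p.1 * g p.2) (A * B) :=
  hf.mul hg (summable_mul_of_summable_norm hf' hg')

lemma hasSum_theta3_sq {y : ℝ} (hy : 0 < y) :
    HasSum (fun p : ℤ × ℤ => Real.exp (-Real.pi * y * ((p.1 : ℝ) ^ 2 + (p.2 : ℝ) ^ 2)))
      (theta3 y ^ 2) := by
  have h := hasSum_theta3 hy
  rw [sq]
  refine (hasSum_mul_of_norm h h h.summable.norm h.summable.norm).congr_fun fun p => ?_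
  rw [← Real.exp_add]
  congr 1; ring

lemma theta3_sq_duplication {y : ℝ} (hy : 0 < y) :
    theta3 y ^ 2 = theta3 (2 * y) ^ 2 + theta2 (2 * y) ^ 2 := by
  have h2 := hasSum_theta2 (mul_pos two_pos hy)
  have h2' := hasSum_theta2' (mul_pos two_pos hy)
  refine (hasSum_theta3_sq hy).unique (hasSum_int_prod_parity ?_ ?_)
  · refine (hasSum_theta3_sq (mul_pos two_pos hy)).congr_fun fun p => ?_
    congr 1; push_cast; ring
  · rw [sq]
    refine (hasSum_mul_of_norm h2' h2 h2'.summable.norm h2.summable.norm).congr_fun fun p => ?_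
    rw [← Real.exp_add]
    congr 1; push_cast; ring

lemma theta4_sq_duplication {y : ℝ} (hy : 0 < y) :
    theta4 y ^ 2 = theta3 (2 * y) ^ 2 - theta2 (2 * y) ^ 2 := by
  have h2 := hasSum_theta2 (mul_pos two_pos hy)
  have h2' := hasSum_theta2' (mul_pos two_pos hy)
  have h4 := hasSum_theta4 hy
  have h := hasSum_mul_of_norm h4 h4 (summable_norm_theta4 hy) (summable_norm_theta4 hy)
  -- The sign depends only on the parity class, so the splitting used for θ₃² applies with the odd
  -- class negated.
  have hsign : ∀ a b : ℤ, (-1 : ℝ) ^ (a + b) * (-1) ^ (a - b) = 1 := fun a b => by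
    rw [← zpow_add₀ (by norm_num), show a + b + (a - b) = 2 * a by ring, zpow_mul]; norm_num
  rw [sq]
  refine h.unique ?_
  rw [sub_eq_add_neg]
  refine hasSum_int_prod_parity ?_ ?_
  · refine (hasSum_theta3_sq (mul_pos two_pos hy)).congr_fun fun p => ?_
    dsimp only
    rw [mul_mul_mul_comm, hsign, one_mul, ← Real.exp_add]
    congr 1; push_cast; ring
  · rw [sq]
    refine (hasSum_mul_of_norm h2' h2 h2'.summable.norm h2.summable.norm).neg.congr_fun fun p => ?_
    dsimp only
    rw [zpow_add₀ (by norm_num : (-1 : ℝ) ≠ 0) (p.1 - p.2) 1, zpow_one, mul_mul_mul_comm,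
      ← mul_assoc ((-1 : ℝ) ^ (p.1 + p.2)), hsign, ← Real.exp_add, ← Real.exp_add, one_mul, neg_one_mul]
    congr 2; push_cast; ring

lemma theta2_sq_duplication {y : ℝ} (hy : 0 < y) :
    theta2 y ^ 2 = 2 * (theta2 (2 * y) * theta3 (2 * y)) := by
  have h2 := hasSum_theta2 (mul_pos two_pos hy)
  have h3 := hasSum_theta3 (mul_pos two_pos hy)
  have h := hasSum_theta2 hy
  have hh := hasSum_mul_of_norm h h h.summable.norm h.summable.norm
  rw [sq, two_mul]
  refine hh.unique (hasSum_int_prod_parity ?_ ?_)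
  · refine (hasSum_mul_of_norm h2 h3 h2.summable.norm h3.summable.norm).congr_fun fun p => ?_
    rw [← Real.exp_add, ← Real.exp_add]
    congr 1; push_cast; ring
  · rw [mul_comm (theta2 (2 * y))]
    refine (hasSum_mul_of_norm h3 h2 h3.summable.norm h2.summable.norm).congr_fun fun p => ?_
    rw [← Real.exp_add, ← Real.exp_add]
    congr 1; push_cast; ring

/-- **Jacobi's identity** `θ₃⁴ = θ₂⁴ + θ₄⁴`. -/
theorem theta3_pow_four {y : ℝ} (hy : 0 < y) :
    theta3 y ^ 4 = theta2 y ^ 4 + theta4 y ^ 4 := by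
  have h3 := theta3_sq_duplication hy
  have h4 := theta4_sq_duplication hy
  have h2 := theta2_sq_duplication hy
  -- With X = θ₃(2y)² and Y = θ₂(2y)² the claim is (X + Y)² = 4XY + (X - Y)².
  have e : ∀ x : ℝ, x ^ 4 = (x ^ 2) ^ 2 := fun x => by ring
  rw [e, e (theta2 y), e (theta4 y), h2, h3, h4]
  ring

lemma nome_pos (y : ℝ) : 0 < nome y := Real.exp_pos _

lemma nome_lt_one {y : ℝ} (hy : 0 < y) : nome y < 1 := by
  rw [nome, Real.exp_lt_one_iff]
  nlinarith [mul_pos Real.pi_pos hy]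

lemma norm_nome_lt_one {y : ℝ} (hy : 0 < y) : ‖((nome y : ℝ) : ℂ)‖ < 1 := by
  rw [Complex.norm_real, Real.norm_of_nonneg (nome_pos y).le]
  exact nome_lt_one hy

lemma norm_neg_nome_lt_one {y : ℝ} (hy : 0 < y) : ‖-((nome y : ℝ) : ℂ)‖ < 1 := by
  rw [norm_neg]; exact norm_nome_lt_one hy

lemma nome_pow (y : ℝ) (n : ℕ) : nome y ^ n = Real.exp (-Real.pi * y * n) := by
  rw [nome, ← Real.exp_nat_mul]; ring_nf

lemma neg_one_zpow_eq_pow_natAbs {K : Type*} [DivisionRing K] (n : ℤ) :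
    (-1 : K) ^ n = (-1) ^ n.natAbs := by
  rcases Int.natAbs_eq n with h | h
  · conv_lhs => rw [h]
    rw [zpow_natCast]
  · conv_lhs => rw [h]
    rw [zpow_neg, zpow_natCast, ← inv_pow, inv_neg, inv_one]

lemma natAbs_sq_cast_real (n : ℤ) : (((n.natAbs ^ 2 : ℕ)) : ℝ) = (n : ℝ) ^ 2 := by
  rw [Nat.cast_pow, Nat.cast_natAbs, Int.cast_abs, sq_abs]

lemma theta4_eq_altTheta (y : ℝ) : (theta4 y : ℂ) = altTheta (nome y) := by
  rw [theta4, altTheta, Complex.ofReal_tsum]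
  refine tsum_congr fun n => ?_
  rw [← Complex.ofReal_pow, nome_pow, natAbs_sq_cast_real, neg_one_zpow_eq_pow_natAbs]
  push_cast
  rfl

/-- As n and n² have the same parity, q ↦ -q removes the signs. So one function of q on the disc
serves for both θ₃ and θ₄. -/
lemma theta3_eq_altTheta (y : ℝ) : (theta3 y : ℂ) = altTheta (-nome y) := by
  rw [theta3, altTheta, Complex.ofReal_tsum]
  refine tsum_congr fun n => ?_
  have h : (-1 : ℂ) ^ n.natAbs * (-1) ^ (n.natAbs ^ 2) = 1 := by
    rw [← pow_add]
    apply Even.neg_one_pow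
    rw [Nat.even_add, Nat.even_pow' two_ne_zero]
  rw [neg_pow (nome y : ℂ), ← mul_assoc, h, one_mul, ← Complex.ofReal_pow, nome_pow, natAbs_sq_cast_real]

lemma theta4_le_one {y : ℝ} (hy : 0 < y) : theta4 y ≤ 1 := by
  have := norm_altTheta_le_one (nome_pos y).le (nome_lt_one hy)
  rw [← theta4_eq_altTheta, Complex.norm_real] at this
  exact (Real.le_norm_self _).trans this

/-! ### Logarithmic derivatives and Lambert series -/

open ArithmeticFunction.sigma in
-- Termwise logarithmic differentiation of Euler's product gives the Lambert series ∑ n qⁿ/(1 - qⁿ).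
lemma hasSum_sigma_eulerProd {q : ℂ} (hq : ‖q‖ < 1) :
    HasSum (fun n : ℕ => ((σ 1 n : ℕ) : ℂ) * q ^ n) (-(q * logDeriv eulerProd q)) := by
  have hmem : q ∈ Metric.ball (0 : ℂ) 1 := by simpa using hq
  have hld : ∀ n : ℕ, logDeriv (fun z : ℂ => 1 - z ^ (n + 1)) q
      = -((n + 1 : ℂ) * q ^ n / (1 - q ^ (n + 1))) := by
    intro n
    have hd : HasDerivAt (fun z : ℂ => 1 - z ^ (n + 1)) (-((n + 1 : ℂ) * q ^ n)) q := by
      simpa using (hasDerivAt_pow (n + 1) q).const_sub 1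
    rw [logDeriv_apply, hd.deriv, neg_div]
  have hsum0 := summable_norm_pow_mul_geometric_div_one_sub 1 hq
  have hsum : Summable fun n : ℕ => (n + 1 : ℂ) * q ^ n / (1 - q ^ (n + 1)) := by
    rcases eq_or_ne q 0 with rfl | h0
    · refine summable_of_ne_finset_zero (s := {0}) fun n hn => ?_
      have : n ≠ 0 := by simpa using hn
      simp [this]
    · refine (((summable_nat_add_iff 1).2 hsum0).mul_left q⁻¹).congr fun n => ?_
      push_cast
      field_simp
      rw [pow_succ']
  have key := logDeriv_tprod_eq_tsum Metric.isOpen_ball hmem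
    (f := fun n z => 1 - z ^ (n + 1)) (fun n => one_sub_pow_succ_ne_zero hq n)
    (fun n => by fun_prop) (hsum.neg.congr fun n => (hld n).symm)
    ModularForm.multipliableLocallyUniformlyOn_one_sub_pow (eulerProd_ne_zero hq)
  have key2 : -(q * logDeriv eulerProd q) = ∑' n : ℕ+, ((σ 1 n : ℕ) : ℂ) * q ^ (n : ℕ) := by
    rw [← tsum_pow_div_one_sub_eq_tsum_sigma hq 1,
      tsum_pnat_eq_tsum_succ (f := fun n : ℕ => (n : ℂ) ^ 1 * q ^ n / (1 - q ^ n))]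
    change logDeriv eulerProd q = _ at key
    rw [key, ← tsum_mul_left, ← tsum_neg]
    refine tsum_congr fun n => ?_
    rw [hld]
    push_cast
    ring
  have hs : Summable fun n : ℕ => ((σ 1 n : ℕ) : ℂ) * q ^ n := by
    refine Summable.of_norm_bounded (summable_norm_pow_mul_geometric_of_norm_lt_one 2 hq) fun n => ?_
    rw [norm_mul, norm_mul]
    gcongr
    rw [Complex.norm_natCast, norm_pow, Complex.norm_natCast]
    exact_mod_cast (ArithmeticFunction.sigma_le_pow_succ 1 n)
  rw [key2]
  rw [tsum_pnat_eq_tsum_succ (f := fun n : ℕ => ((σ 1 n : ℕ) : ℂ) * q ^ n)]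
  have := hs.hasSum
  rwa [hs.tsum_eq_zero_add, ArithmeticFunction.map_zero, Nat.cast_zero, zero_mul, zero_add] at this

lemma differentiableAt_eulerProd {q : ℂ} (hq : ‖q‖ < 1) : DifferentiableAt ℂ eulerProd q :=
  ModularForm.differentiableOn_tprod_one_sub_pow.differentiableAt
    (Metric.isOpen_ball.mem_nhds (by simpa using hq))

lemma eventually_norm_lt_one {q : ℂ} (hq : ‖q‖ < 1) : ∀ᶠ z in 𝓝 q, ‖z‖ < 1 :=
  continuous_norm.continuousAt.eventually_lt continuousAt_const hq

lemma altTheta_eventuallyEq {q : ℂ} (hq : ‖q‖ < 1) :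
    altTheta =ᶠ[𝓝 q] fun z => eulerProd z ^ 2 / eulerProd (z ^ 2) := by
  filter_upwards [eventually_norm_lt_one hq] with z hz using altTheta_eq hz

lemma hasDerivAt_eulerProd_sq {q : ℂ} (hq : ‖q‖ < 1) :
    HasDerivAt (fun z => eulerProd (z ^ 2)) (deriv eulerProd (q ^ 2) * (2 * q)) q := by
  have h1 := (differentiableAt_eulerProd (norm_sq_lt_one hq)).hasDerivAt
  have h2 : HasDerivAt (fun z : ℂ => z ^ 2) (2 * q) q := by simpa using hasDerivAt_pow 2 q
  exact HasDerivAt.comp q h1 h2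

lemma differentiableAt_altTheta {q : ℂ} (hq : ‖q‖ < 1) : DifferentiableAt ℂ altTheta q :=
  (((differentiableAt_eulerProd hq).pow 2).div (hasDerivAt_eulerProd_sq hq).differentiableAt
    (eulerProd_ne_zero (norm_sq_lt_one hq))).congr_of_eventuallyEq (altTheta_eventuallyEq hq)

lemma logDeriv_altTheta {q : ℂ} (hq : ‖q‖ < 1) :
    q * logDeriv altTheta q
      = 2 * (q * logDeriv eulerProd q) - 2 * (q ^ 2 * logDeriv eulerProd (q ^ 2)) := by
  have hP := eulerProd_ne_zero hq
  have hP2 := eulerProd_ne_zero (norm_sq_lt_one hq)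
  have hd := (((differentiableAt_eulerProd hq).hasDerivAt.pow 2).div (hasDerivAt_eulerProd_sq hq)
    hP2).congr_of_eventuallyEq (altTheta_eventuallyEq hq)
  rw [logDeriv_apply, hd.deriv, altTheta_eq hq, logDeriv_apply, logDeriv_apply]
  simp only [Pi.pow_apply]
  field_simp
  push_cast
  ring

open ArithmeticFunction.sigma in
-- For n = 2^k m with m odd, σ₁(n) = (2^(k+1) - 1)σ₁(m), and subtracting the same with k - 1 leaves
-- 2^k σ₁(m). The difference σ₁(n) - σ₁(n/2) is what the quotient P(q)²/P(q²) of Euler products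
-- produces.
lemma a_eq {n : ℕ} (hn : n ≠ 0) :
    a n + (if Even n then σ 1 (n / 2) else 0) = σ 1 n := by
  obtain ⟨k, m, hm, rfl⟩ := Nat.exists_eq_two_pow_mul_odd hn
  have hcop : Nat.Coprime (2 ^ k) m := Nat.Coprime.pow_left k (Nat.coprime_two_left.2 hm)
  have ha : a (2 ^ k * m) = 2 ^ k * σ 1 m := by
    rw [a, Nat.factorization_mul_of_coprime hcop, Finsupp.prod_add_index_of_disjoint
      (by simpa only [Nat.support_factorization] using hcop.disjoint_primeFactors)]
    congr 1
    · rw [Nat.Prime.factorization_pow Nat.prime_two, Finsupp.prod_single_index] <;> simp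
    · rw [ArithmeticFunction.isMultiplicative_sigma.multiplicative_factorization _ hm.pos.ne']
      refine Finsupp.prod_congr fun p hp => if_neg ?_
      rintro rfl
      exact hm.not_two_dvd_nat (Nat.dvd_of_mem_primeFactors (by simpa using hp))
  have hσ : ∀ k, σ 1 (2 ^ k * m) = (2 ^ (k + 1) - 1) * σ 1 m := by
    intro k
    have hcop : Nat.Coprime (2 ^ k) m := Nat.Coprime.pow_left k (Nat.coprime_two_left.2 hm)
    rw [ArithmeticFunction.isMultiplicative_sigma.map_mul_of_coprime hcop,
      ArithmeticFunction.sigma_one_apply_prime_pow Nat.prime_two, Nat.geomSum_eq le_rfl]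
    simp
  rw [ha, hσ]
  have h1 : 1 ≤ 2 ^ k := Nat.one_le_two_pow
  cases k with
  | zero =>
    rw [if_neg (by simpa using hm)]
    simp
  | succ k =>
    have he : Even (2 ^ (k + 1) * m) := (Nat.even_pow.2 ⟨even_two, k.succ_ne_zero⟩).mul_right m
    have hdiv : 2 ^ (k + 1) * m / 2 = 2 ^ k * m := by
      rw [pow_succ, mul_right_comm, Nat.mul_div_cancel _ two_pos]
    rw [if_pos he, hdiv, hσ]
    have h2 : 1 ≤ 2 ^ (k + 1) := Nat.one_le_two_pow
    zify [h2, Nat.one_le_two_pow (n := k + 1 + 1)]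
    ring

lemma hasSum_a {q : ℂ} (hq : ‖q‖ < 1) :
    HasSum (fun n : ℕ => (a (n + 1) : ℂ) * q ^ (n + 1)) (-(q * logDeriv altTheta q) / 2) := by
  have h1 := hasSum_sigma_eulerProd hq
  have h2 := hasSum_sigma_eulerProd (norm_sq_lt_one hq)
  have hinj : Function.Injective (fun n : ℕ => 2 * n) := mul_right_injective₀ two_ne_zero
  have h3 : HasSum (fun n : ℕ => ((if Even n then ArithmeticFunction.sigma 1 (n / 2) else 0 : ℕ) : ℂ)
      * q ^ n) (-(q ^ 2 * logDeriv eulerProd (q ^ 2))) := by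
    rw [← hinj.hasSum_iff]
    · refine h2.congr_fun fun n => ?_
      simp [pow_mul]
    · intro n hn
      rw [if_neg, Nat.cast_zero, zero_mul]
      rintro ⟨k, rfl⟩
      exact hn ⟨k, by ring⟩
  have h4 := (hasSum_nat_add_iff' 1).2 (h1.sub h3)
  have e : -(q * logDeriv eulerProd q) - -(q ^ 2 * logDeriv eulerProd (q ^ 2))
      = -(q * logDeriv altTheta q) / 2 := by
    rw [logDeriv_altTheta hq]; ring
  rw [e] at h4
  simp only [Finset.sum_range_one, ArithmeticFunction.map_zero, Nat.zero_div, ite_self,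
    Nat.cast_zero, zero_mul, sub_zero] at h4
  refine h4.congr_fun fun n => ?_
  rw [← a_eq n.succ_ne_zero]
  push_cast
  ring

lemma hasDerivAt_cexp_nome (y : ℝ) :
    HasDerivAt (fun z : ℂ => Complex.exp (-Real.pi * z)) (-Real.pi * (nome y : ℂ)) (y : ℂ) := by
  have h : HasDerivAt (fun z : ℂ => -(Real.pi : ℂ) * z) (-Real.pi) (y : ℂ) := by
    simpa using (hasDerivAt_id (y : ℂ)).const_mul (-(Real.pi : ℂ))
  have e : (nome y : ℂ) = Complex.exp (-Real.pi * y) := by rw [nome]; push_cast; rfl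
  rw [e, mul_comm]
  exact h.cexp

lemma cexp_ofReal_eq_nome (x : ℝ) : Complex.exp (-Real.pi * x) = (nome x : ℂ) := by
  rw [nome]; push_cast; rfl

/-- Brings derivatives computed in the complex disc back to the real theta functions; the second
conclusion records that such a derivative is real. -/
lemma HasDerivAt_real_of_ofReal {f : ℝ → ℝ} {g : ℂ → ℂ} {g' : ℂ} {y : ℝ}
    (h : HasDerivAt g g' (y : ℂ)) (hfg : ∀ x : ℝ, (f x : ℂ) = g x) :
    HasDerivAt f g'.re y ∧ (g'.re : ℂ) = g' := by
  have h1 : HasDerivAt f g'.re y := by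
    have := h.real_of_complex
    refine this.congr_of_eventuallyEq (Eventually.of_forall fun x => ?_)
    dsimp only
    rw [← hfg, Complex.ofReal_re]
  refine ⟨h1, ?_⟩
  have h2 := h.comp_ofReal
  have h3 : HasDerivAt (fun x : ℝ => g x) (g'.re : ℂ) y := by
    refine h1.ofReal_comp.congr_of_eventuallyEq (Eventually.of_forall fun x => (hfg x).symm)
  exact h3.unique h2

lemma hasDerivAt_theta4 {y : ℝ} (hy : 0 < y) :
    HasDerivAt theta4 (deriv theta4 y) y ∧ ((deriv theta4 y / theta4 y : ℝ) : ℂ)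
      = -Real.pi * ((nome y : ℂ) * logDeriv altTheta (nome y)) := by
  have h0 := (differentiableAt_altTheta (norm_nome_lt_one hy)).hasDerivAt
  rw [← cexp_ofReal_eq_nome] at h0
  have h := HasDerivAt.comp (y : ℂ) h0 (hasDerivAt_cexp_nome y)
  obtain ⟨h1, h2⟩ := HasDerivAt_real_of_ofReal (f := theta4) h fun x => by
    rw [Function.comp, cexp_ofReal_eq_nome, theta4_eq_altTheta]
  refine ⟨h1.differentiableAt.hasDerivAt, ?_⟩
  rw [h1.deriv, Complex.ofReal_div, h2, theta4_eq_altTheta, logDeriv_apply, cexp_ofReal_eq_nome]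
  ring

lemma hasDerivAt_theta3 {y : ℝ} (hy : 0 < y) :
    HasDerivAt theta3 (deriv theta3 y) y ∧ ((deriv theta3 y / theta3 y : ℝ) : ℂ)
      = -Real.pi * (-(nome y : ℂ) * logDeriv altTheta (-nome y)) := by
  have h0 := (differentiableAt_altTheta (norm_neg_nome_lt_one hy)).hasDerivAt
  rw [← cexp_ofReal_eq_nome] at h0
  have h := HasDerivAt.comp (y : ℂ) h0 (hasDerivAt_cexp_nome y).neg
  obtain ⟨h1, h2⟩ := HasDerivAt_real_of_ofReal (f := theta3) h fun x => by
    simp only [Function.comp, Pi.neg_apply]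
    rw [cexp_ofReal_eq_nome, theta3_eq_altTheta]
  refine ⟨h1.differentiableAt.hasDerivAt, ?_⟩
  rw [h1.deriv, Complex.ofReal_div, h2, theta3_eq_altTheta, logDeriv_apply, cexp_ofReal_eq_nome]
  ring

theorem hasSum_a2 {y : ℝ} (hy : 0 < y) :
    HasSum (fun n : ℕ => Real.pi * (a2 (n + 1) * nome y ^ (n + 1)))
      (4 * (deriv theta4 y / theta4 y) - 2 * (deriv theta3 y / theta3 y)) := by
  rw [← Complex.hasSum_ofReal, Complex.ofReal_sub, Complex.ofReal_mul, Complex.ofReal_mul,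
    (hasDerivAt_theta4 hy).2, (hasDerivAt_theta3 hy).2]
  -- θ₄ contributes the series at q and θ₃ the one at -q, whence the factor 8 - 4(-1)ⁿ in a₂(n).
  have h := ((hasSum_a (norm_nome_lt_one hy)).mul_left (8 * Real.pi : ℂ)).sub
    ((hasSum_a (norm_neg_nome_lt_one hy)).mul_left (4 * Real.pi : ℂ))
  convert! h using 1
  · funext n
    rw [a2, neg_pow (nome y : ℂ)]
    push_cast
    ring
  · push_cast
    ring

lemma abs_a2_le {n : ℕ} (hn : n ≠ 0) : |a2 n| ≤ 12 * (n : ℝ) ^ 2 := by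
  have h1 : a n ≤ n ^ 2 := by
    have := a_eq hn
    exact le_trans (by omega) (ArithmeticFunction.sigma_le_pow_succ 1 n)
  have h2 : |2 * (4 - 2 * (-1 : ℝ) ^ n)| ≤ 12 := by
    rcases neg_one_pow_eq_or ℝ n with h | h <;> rw [h] <;> norm_num
  rw [a2, abs_mul, Nat.abs_cast]
  have h3 : (a n : ℝ) ≤ (n : ℝ) ^ 2 := by exact_mod_cast h1
  gcongr

/-! ### The `q`-expansion of `θ₂⁴ / θ₃²` -/

/-- The power series `P` converges to `f` on the open unit disc. -/
def IsDiscExpansion (P : PowerSeries ℂ) (f : ℂ → ℂ) : Prop :=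
  ∀ z : ℂ, ‖z‖ < 1 → HasSum (fun n => PowerSeries.coeff n P * z ^ n) (f z)

lemma IsDiscExpansion.summable_norm {P : PowerSeries ℂ} {f : ℂ → ℂ} (h : IsDiscExpansion P f)
    {z : ℂ} (hz : ‖z‖ < 1) : Summable fun n => ‖PowerSeries.coeff n P * z ^ n‖ := by
  obtain ⟨ρ, h1, h2⟩ := exists_between hz
  have h0 : 0 < ρ := (norm_nonneg z).trans_lt h1
  have hρ : ‖(ρ : ℂ)‖ = ρ := by rw [Complex.norm_real, Real.norm_of_nonneg h0.le]
  obtain ⟨C, hC⟩ := (Metric.isBounded_range_of_tendsto _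
    (h ρ (hρ.trans_lt h2)).summable.tendsto_atTop_zero).exists_norm_le
  have hlt : ‖z‖ / ρ < 1 := (div_lt_one h0).2 h1
  refine Summable.of_nonneg_of_le (fun _ => norm_nonneg _) (fun n => ?_)
    ((summable_geometric_of_lt_one (by positivity) hlt).mul_left C)
  have h3 := hC _ ⟨n, rfl⟩
  dsimp only at h3
  rw [norm_mul, norm_pow, hρ] at h3
  rw [norm_mul, norm_pow, div_pow, ← mul_div_assoc, le_div_iff₀ (by positivity)]
  calc _ = (‖PowerSeries.coeff n P‖ * ρ ^ n) * ‖z‖ ^ n := by ring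
    _ ≤ _ := by gcongr

lemma IsDiscExpansion.mul {P Q : PowerSeries ℂ} {f g : ℂ → ℂ} (hP : IsDiscExpansion P f)
    (hQ : IsDiscExpansion Q g) : IsDiscExpansion (P * Q) (fun z => f z * g z) := by
  intro z hz
  have h1 := hP.summable_norm hz
  have h2 := hQ.summable_norm hz
  have e : ∀ n, PowerSeries.coeff n (P * Q) * z ^ n = ∑ kl ∈ Finset.HasAntidiagonal.antidiagonal n,
      (PowerSeries.coeff kl.1 P * z ^ kl.1) * (PowerSeries.coeff kl.2 Q * z ^ kl.2) := by
    intro n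
    rw [PowerSeries.coeff_mul, Finset.sum_mul]
    refine Finset.sum_congr rfl fun kl hkl => ?_
    rw [← Finset.HasAntidiagonal.mem_antidiagonal.1 hkl, pow_add]
    ring
  simp_rw [e]
  rw [← (hP z hz).tsum_eq, ← (hQ z hz).tsum_eq,
    tsum_mul_tsum_eq_tsum_sum_antidiagonal_of_summable_norm h1 h2]
  exact (summable_norm_sum_mul_antidiagonal_of_summable_norm h1 h2).of_norm.hasSum

lemma isDiscExpansion_one : IsDiscExpansion 1 (fun _ => 1) := by
  intro z _
  convert! hasSum_single (f := fun n => PowerSeries.coeff n (1 : PowerSeries ℂ) * z ^ n) 0 ?_ using 1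
  · simp
  · intro n hn
    simp [PowerSeries.coeff_one, hn]

lemma IsDiscExpansion.pow {P : PowerSeries ℂ} {f : ℂ → ℂ} (hP : IsDiscExpansion P f) (n : ℕ) :
    IsDiscExpansion (P ^ n) (fun z => f z ^ n) := by
  induction n with
  | zero => simpa using isDiscExpansion_one
  | succ n ih => simpa only [pow_succ] using ih.mul hP

lemma isDiscExpansion_X : IsDiscExpansion PowerSeries.X (fun z => z) := by
  intro z _
  convert! hasSum_single (f := fun n => PowerSeries.coeff n (PowerSeries.X : PowerSeries ℂ) * z ^ n)
    1 ?_ using 1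
  · simp
  · intro n hn
    simp [PowerSeries.coeff_X, hn]

lemma IsDiscExpansion.const_mul {P : PowerSeries ℂ} {f : ℂ → ℂ} (hP : IsDiscExpansion P f) (c : ℂ) :
    IsDiscExpansion (PowerSeries.C c * P) (fun z => c * f z) := by
  intro z hz
  refine ((hP z hz).mul_left c).congr_fun fun n => ?_
  rw [PowerSeries.coeff_C_mul, mul_assoc]

lemma IsDiscExpansion.hasFPowerSeriesOnBall {P : PowerSeries ℂ} {f : ℂ → ℂ}
    (hP : IsDiscExpansion P f) : HasFPowerSeriesOnBall f
      (FormalMultilinearSeries.ofScalars ℂ fun n => PowerSeries.coeff n P) 0 1 where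
  r_le := by
    refine ENNReal.le_of_forall_nnreal_lt fun r hr => ?_
    have hr1 : r < 1 := by exact_mod_cast hr
    have hn : ‖((r : ℝ) : ℂ)‖ < 1 := by
      rw [Complex.norm_real, NNReal.norm_eq]; exact_mod_cast hr1
    refine FormalMultilinearSeries.le_radius_of_tendsto _ (l := 0) ?_
    refine (hP.summable_norm hn).tendsto_atTop_zero.congr fun n => ?_
    rw [FormalMultilinearSeries.ofScalars_norm, norm_mul, norm_pow, Complex.norm_real,
      NNReal.norm_eq]
  r_pos := one_pos
  hasSum := by
    intro z hz
    rw [zero_add]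
    have hz' : ‖z‖ < 1 := by
      rw [Metric.mem_eball, edist_zero_right] at hz
      rw [← toReal_enorm]
      exact ENNReal.toReal_lt_of_lt_ofReal (by simpa using hz)
    refine (hP z hz').congr_fun fun n => ?_
    rw [FormalMultilinearSeries.ofScalars_apply_eq, smul_eq_mul]

lemma IsDiscExpansion.unique {P Q : PowerSeries ℂ} {f : ℂ → ℂ}
    (hP : IsDiscExpansion P f) (hQ : IsDiscExpansion Q f) : P = Q := by
  have h := hP.hasFPowerSeriesOnBall.hasFPowerSeriesAt.eq_formalMultilinearSeries
    hQ.hasFPowerSeriesOnBall.hasFPowerSeriesAt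
  have h2 := FormalMultilinearSeries.ofScalars_series_injective ℂ ℂ h
  ext n
  exact congrFun h2 n

lemma IsDiscExpansion.differentiableOn {P : PowerSeries ℂ} {f : ℂ → ℂ}
    (hP : IsDiscExpansion P f) : DifferentiableOn ℂ f (Metric.ball 0 1) := by
  have := hP.hasFPowerSeriesOnBall.differentiableOn
  rwa [← ENNReal.coe_one, Metric.eball_coe] at this

lemma IsDiscExpansion.congr {P : PowerSeries ℂ} {f g : ℂ → ℂ} (hP : IsDiscExpansion P f)
    (h : ∀ z, ‖z‖ < 1 → f z = g z) : IsDiscExpansion P g :=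
  fun z hz => h z hz ▸ hP z hz

lemma exists_isDiscExpansion {f : ℂ → ℂ} (hf : DifferentiableOn ℂ f (Metric.ball 0 1)) :
    ∃ P : PowerSeries ℂ, IsDiscExpansion P f := by
  refine ⟨PowerSeries.mk fun n => (n.factorial : ℂ)⁻¹ * iteratedDeriv n f 0, fun z hz => ?_⟩
  refine (Complex.hasSum_taylorSeries_on_ball hf (z := z) (by simpa using hz)).congr_fun fun n => ?_
  rw [PowerSeries.coeff_mk, sub_zero, smul_eq_mul, smul_eq_mul]
  ring

/-- Cauchy's estimate. -/
lemma IsDiscExpansion.norm_coeff_le {P : PowerSeries ℂ} {f : ℂ → ℂ} (hP : IsDiscExpansion P f)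
    {r C : ℝ} (h0 : 0 < r) (h1 : r < 1) (hC : ∀ z : ℂ, ‖z‖ = r → ‖f z‖ ≤ C) (n : ℕ) :
    ‖PowerSeries.coeff n P‖ ≤ C / r ^ n := by
  have hd := hP.differentiableOn
  have e : PowerSeries.coeff n P = (n.factorial : ℂ)⁻¹ * iteratedDeriv n f 0 := by
    have hQ : IsDiscExpansion (PowerSeries.mk fun n => (n.factorial : ℂ)⁻¹ * iteratedDeriv n f 0) f := by
      intro z hz
      refine (Complex.hasSum_taylorSeries_on_ball hd (z := z) (by simpa using hz)).congr_fun
        fun n => ?_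
      rw [PowerSeries.coeff_mk, sub_zero, smul_eq_mul, smul_eq_mul]
      ring
    rw [hP.unique hQ, PowerSeries.coeff_mk]
  have hcl : DiffContOnCl ℂ f (Metric.ball 0 r) :=
    (hd.mono (Metric.closure_ball_subset_closedBall.trans
      (Metric.closedBall_subset_ball h1))).diffContOnCl
  have h := Complex.norm_iteratedDeriv_le_of_forall_mem_sphere_norm_le n h0 hcl
    (fun z hz => hC z (by simpa using hz))
  have hn : (0 : ℝ) < n.factorial := by positivity
  rw [e, norm_mul, norm_inv, Complex.norm_natCast, inv_mul_le_iff₀ hn, ← mul_div_assoc]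
  exact h

/-- The series `∑_{k ≥ 0} q^(k (k + 1))`. -/
def triTheta (q : ℂ) : ℂ := ∑' k : ℕ, q ^ (k * (k + 1))

lemma summable_pow_mul_succ {r : ℝ} (h0 : 0 ≤ r) (h1 : r < 1) :
    Summable fun k : ℕ => r ^ (k * (k + 1)) :=
  Summable.of_nonneg_of_le (fun n => by positivity)
    (fun n => pow_le_pow_of_le_one h0 h1.le (Nat.le_mul_of_pos_right n n.succ_pos))
    (summable_geometric_of_lt_one h0 h1)

lemma hasSum_triTheta {q : ℂ} (hq : ‖q‖ < 1) :
    HasSum (fun k : ℕ => q ^ (k * (k + 1))) (triTheta q) :=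
  (Summable.of_norm (by simpa using summable_pow_mul_succ (norm_nonneg q) hq)).hasSum

lemma mul_succ_injective : Function.Injective fun k : ℕ => k * (k + 1) := by
  intro a b h
  dsimp only at h
  rcases lt_trichotomy a b with h1 | h1 | h1
  · nlinarith
  · exact h1
  · nlinarith

open scoped Classical in
lemma isDiscExpansion_triTheta : IsDiscExpansion
    (PowerSeries.mk fun n => if ∃ k : ℕ, n = k * (k + 1) then (1 : ℂ) else 0) triTheta := by
  intro z hz
  rw [← mul_succ_injective.hasSum_iff]
  · refine (hasSum_triTheta hz).congr_fun fun k => ?_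
    rw [Function.comp, PowerSeries.coeff_mk, if_pos ⟨k, rfl⟩, one_mul]
  · intro n hn
    rw [PowerSeries.coeff_mk, if_neg, zero_mul]
    rintro ⟨k, rfl⟩
    exact hn ⟨k, rfl⟩

lemma hasSum_altTheta {q : ℂ} (hq : ‖q‖ < 1) :
    HasSum (fun n : ℤ => (-1) ^ n.natAbs * q ^ (n.natAbs ^ 2)) (altTheta q) := by
  refine (Summable.of_norm ?_).hasSum
  simpa using summable_pow_natAbs_sq (norm_nonneg q) hq

lemma hasSum_altTheta_neg {q : ℂ} (hq : ‖q‖ < 1) :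
    HasSum (fun k : ℕ => 2 * q ^ ((k + 1) ^ 2)) (altTheta (-q) - 1) := by
  have h := (hasSum_nat_add_iff' 1).2 (hasSum_altTheta (q := -q) (by simpa using hq)).nat_add_neg
  simp only [Finset.sum_range_one, Nat.cast_zero, neg_zero, Int.natAbs_zero, pow_zero, one_mul,
    ne_eq, OfNat.ofNat_ne_zero, not_false_eq_true, zero_pow, add_sub_add_right_eq_sub] at h
  refine h.congr_fun fun k => ?_
  rw [Int.natAbs_neg, Int.natAbs_natCast, neg_pow q, ← mul_assoc, ← pow_add]
  have : Even (k + 1 + (k + 1) ^ 2) := by rw [Nat.even_add, Nat.even_pow' two_ne_zero]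
  rw [this.neg_one_pow]
  ring

lemma isDiscExpansion_theta3Series :
    IsDiscExpansion (theta3Series.map Complex.ofRealHom) (fun q => altTheta (-q)) := by
  classical
  intro z hz
  have hinj : Function.Injective fun k : ℕ => (k + 1) ^ 2 := fun a b h => by
    have := Nat.pow_left_injective two_ne_zero h
    omega
  have h1 : HasSum (fun n : ℕ => (if n ≠ 0 ∧ IsSquare n then (2 : ℂ) else 0) * z ^ n)
      (altTheta (-z) - 1) := by
    rw [← hinj.hasSum_iff]
    · refine (hasSum_altTheta_neg hz).congr_fun fun k => ?_
      rw [Function.comp, if_pos ⟨by positivity, ⟨k + 1, sq _⟩⟩]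
    · intro n hn
      rw [if_neg, zero_mul]
      rintro ⟨h0, k, rfl⟩
      obtain ⟨j, rfl⟩ := Nat.exists_eq_succ_of_ne_zero (left_ne_zero_of_mul h0)
      exact hn ⟨j, sq _⟩
  have h2 := (hasSum_ite_eq 0 (1 : ℂ)).add h1
  rw [add_sub_cancel] at h2
  refine h2.congr_fun fun n => ?_
  rw [PowerSeries.coeff_map, theta3Series, PowerSeries.coeff_mk]
  rcases eq_or_ne n 0 with rfl | h0
  · simp
  · by_cases hs : IsSquare n <;> simp [h0, hs]

lemma isDiscExpansion_theta2Pow4Series :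
    IsDiscExpansion (theta2Pow4Series.map Complex.ofRealHom) (fun q => 16 * (q * triTheta q ^ 4)) := by
  classical
  have e : theta2Pow4Series.map Complex.ofRealHom = PowerSeries.C 16 * (PowerSeries.X *
      (PowerSeries.mk fun n => if ∃ k : ℕ, n = k * (k + 1) then (1 : ℂ) else 0) ^ 4) := by
    have e1 : (PowerSeries.mk fun n => if ∃ k : ℕ, n = k * (k + 1) then (1 : ℝ) else 0).map
        Complex.ofRealHom = PowerSeries.mk fun n => if ∃ k : ℕ, n = k * (k + 1) then (1 : ℂ) else 0 := by
      ext n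
      rw [PowerSeries.coeff_map, PowerSeries.coeff_mk, PowerSeries.coeff_mk]
      split_ifs <;> simp
    have e2 : (PowerSeries.C 16 : PowerSeries ℂ) = 16 := map_ofNat _ 16
    rw [theta2Pow4Series, map_mul, map_mul, map_pow, PowerSeries.map_X, mul_assoc, e1, e2,
      map_ofNat]
  rw [e]
  exact (isDiscExpansion_X.mul (isDiscExpansion_triTheta.pow 4)).const_mul 16

/-- The function `θ₂⁴ / θ₃²` of the nome. -/
def theta2Quot (q : ℂ) : ℂ := 16 * (q * triTheta q ^ 4) / altTheta (-q) ^ 2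

lemma differentiableOn_theta2Quot : DifferentiableOn ℂ theta2Quot (Metric.ball 0 1) := by
  refine isDiscExpansion_theta2Pow4Series.differentiableOn.div
    (isDiscExpansion_theta3Series.pow 2).differentiableOn fun z hz => ?_
  exact pow_ne_zero _ (altTheta_ne_zero (by simpa using hz))

/-- θ₃ has no zeros in the disc, so θ₂⁴/θ₃² has a convergent Taylor series there. Times the series
of θ₃² it is that of θ₂⁴, and cancelling in the domain of power series identifies it with the formal
quotient. -/
lemma isDiscExpansion_b2 :
    IsDiscExpansion (PowerSeries.mk fun m => (b2 m : ℂ)) theta2Quot := by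
  obtain ⟨P, hP⟩ := exists_isDiscExpansion differentiableOn_theta2Quot
  have h1 := hP.mul (isDiscExpansion_theta3Series.pow 2)
  have h2 : IsDiscExpansion (P * theta3Series.map Complex.ofRealHom ^ 2)
      (fun q => 16 * (q * triTheta q ^ 4)) := by
    refine h1.congr fun z hz => ?_
    rw [theta2Quot, div_mul_cancel₀]
    exact pow_ne_zero _ (altTheta_ne_zero (by simpa using hz))
  have h3 := h2.unique isDiscExpansion_theta2Pow4Series
  have hc : PowerSeries.constantCoeff (theta3Series ^ 2) ≠ 0 := by
    rw [map_pow, ← PowerSeries.coeff_zero_eq_constantCoeff_apply, theta3Series,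
      PowerSeries.coeff_mk]
    simp
  have h4 : (theta2Pow4Series * (theta3Series ^ 2)⁻¹) * theta3Series ^ 2 = theta2Pow4Series := by
    rw [mul_assoc, PowerSeries.inv_mul_cancel _ hc, mul_one]
  have h5 := congrArg (PowerSeries.map Complex.ofRealHom) h4
  rw [map_mul, ← h3, map_pow] at h5
  have hne : theta3Series.map Complex.ofRealHom ^ 2 ≠ 0 := by
    rw [← map_pow]
    intro h
    have := congrArg (PowerSeries.coeff 0) h
    rw [PowerSeries.coeff_map, map_zero] at this
    exact hc (by simpa using this)
  have h6 := mul_right_cancel₀ hne h5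
  have h7 : (PowerSeries.mk fun m => (b2 m : ℂ)) = P := by
    rw [← h6]
    ext m
    rw [PowerSeries.coeff_mk, PowerSeries.coeff_map]
    rfl
  rw [h7]
  exact hP

lemma b2_zero : b2 0 = 0 := by
  rw [b2, PowerSeries.coeff_zero_eq_constantCoeff_apply, theta2Pow4Series]
  simp

/-- The indices k and -k-1 give equal terms of θ₂, and (k + 1/2)² = k(k + 1) + 1/4. -/
lemma hasSum_triTheta_real {y : ℝ} (hy : 0 < y) :
    HasSum (fun k : ℕ => nome y ^ (k * (k + 1))) (theta2 y / (2 * Real.exp (-Real.pi * y / 4))) := by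
  have h := (hasSum_theta2' hy).nat_add_neg_add_one.mul_left (2 * Real.exp (-Real.pi * y / 4))⁻¹
  rw [div_eq_inv_mul]
  refine h.congr_fun fun k => ?_
  have e1 : Real.exp (-Real.pi * y * (((k : ℤ) : ℝ) + 1 / 2) ^ 2)
      = Real.exp (-Real.pi * y / 4) * nome y ^ (k * (k + 1)) := by
    rw [nome_pow, ← Real.exp_add]; congr 1; push_cast; ring
  have e2 : Real.exp (-Real.pi * y * (((-((k : ℤ) + 1) : ℤ) : ℝ) + 1 / 2) ^ 2)
      = Real.exp (-Real.pi * y / 4) * nome y ^ (k * (k + 1)) := by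
    rw [← e1]; congr 1; push_cast; ring
  rw [e1, e2]
  field_simp
  norm_num

lemma nome_eq_exp_quarter (y : ℝ) : nome y = Real.exp (-Real.pi * y / 4) ^ 4 := by
  rw [nome, ← Real.exp_nat_mul]; congr 1; push_cast; ring

lemma theta2Quot_nome {y : ℝ} (hy : 0 < y) :
    theta2Quot (nome y) = ((theta2 y ^ 4 / theta3 y ^ 2 : ℝ) : ℂ) := by
  have h : triTheta (nome y) = ((theta2 y / (2 * Real.exp (-Real.pi * y / 4)) : ℝ) : ℂ) := by
    refine (hasSum_triTheta (norm_nome_lt_one hy)).unique ?_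
    simpa using Complex.hasSum_ofReal.2 (hasSum_triTheta_real hy)
  have h0 : Real.exp (-Real.pi * y / 4) ≠ 0 := (Real.exp_pos _).ne'
  rw [theta2Quot, ← theta3_eq_altTheta, h, nome_eq_exp_quarter]
  norm_cast
  congr 1
  field_simp
  ring

lemma hasSum_b2 {y : ℝ} (hy : 0 < y) :
    HasSum (fun m : ℕ => b2 (m + 1) * nome y ^ (m + 1)) (theta2 y ^ 4 / theta3 y ^ 2) := by
  have h := isDiscExpansion_b2 (nome y) (norm_nome_lt_one hy)
  rw [theta2Quot_nome hy] at h
  simp only [PowerSeries.coeff_mk, ← Complex.ofReal_pow, ← Complex.ofReal_mul] at h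
  have h2 := (hasSum_nat_add_iff' 1).2 (Complex.hasSum_ofReal.1 h)
  simpa [b2_zero] using h2

lemma theta3_sq_mul_lam {y : ℝ} (hy : 0 < y) :
    theta3 y ^ 2 * lam y = theta2 y ^ 4 / theta3 y ^ 2 := by
  have := (theta3_pos hy).ne'
  rw [lam]
  field_simp

/-- The numerator has nonnegative coefficients, so it is largest at the positive point of the
circle; the denominator is bounded below by `norm_altTheta_ge`. -/
lemma norm_theta2Quot_le {y : ℝ} (hy : 0 < y) {z : ℂ} (hz : ‖z‖ = nome y) :
    ‖theta2Quot z‖ ≤ theta2 y ^ 4 / theta4 y ^ 2 := by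
  have hz1 : ‖z‖ < 1 := hz ▸ nome_lt_one hy
  have h1 : ‖triTheta z‖ ≤ theta2 y / (2 * Real.exp (-Real.pi * y / 4)) := by
    refine tsum_of_norm_bounded (hasSum_triTheta_real hy) fun k => ?_
    rw [norm_pow, hz]
  have h2 : theta4 y ≤ ‖altTheta (-z)‖ := by
    have := norm_altTheta_ge (q := -z) (by simpa using hz1)
    rwa [norm_neg, hz, ← theta4_eq_altTheta, Complex.norm_real,
      Real.norm_of_nonneg (theta4_pos hy).le] at this
  have h3 := theta4_pos hy
  rw [theta2Quot, norm_div, norm_mul, norm_mul, norm_pow, norm_pow, hz]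
  have h4 : ‖(16 : ℂ)‖ * (nome y * ‖triTheta z‖ ^ 4) ≤ theta2 y ^ 4 := by
    calc _ ≤ 16 * (nome y * (theta2 y / (2 * Real.exp (-Real.pi * y / 4))) ^ 4) := by
          have := (nome_pos y).le
          have h16 : ‖(16 : ℂ)‖ = 16 := by norm_num
          rw [h16]
          gcongr
      _ = theta2 y ^ 4 := by
          have h0 : Real.exp (-Real.pi * y / 4) ≠ 0 := (Real.exp_pos _).ne'
          rw [nome_eq_exp_quarter]
          field_simp
          ring
  gcongr

/-- Cauchy's estimate on the circle of radius `nome y`, where inversion gives θ₂⁴ ≤ y⁻² and θ₄² ≥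
y⁻¹ exp(-π/(2y)). The parameter y stays free, to be chosen later. -/
lemma abs_b2_le {y : ℝ} (hy : 0 < y) (m : ℕ) :
    |b2 m| ≤ 1 / y * Real.exp (Real.pi / (2 * y) + Real.pi * m * y) := by
  have h := isDiscExpansion_b2.norm_coeff_le (nome_pos y) (nome_lt_one hy)
    (fun z hz => norm_theta2Quot_le hy hz) m
  rw [PowerSeries.coeff_mk, Complex.norm_real, Real.norm_eq_abs] at h
  refine h.trans ?_
  have hy' : 0 < 1 / y := one_div_pos.2 hy
  have e2 := theta2_inv hy'
  have e4 := theta4_inv hy'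
  rw [one_div_one_div] at e2 e4
  have hs : Real.sqrt (1 / y) ^ 2 = 1 / y := Real.sq_sqrt hy'.le
  have h2 : theta2 y ^ 4 ≤ (1 / y) ^ 2 := by
    rw [e2, mul_pow, show Real.sqrt (1 / y) ^ 4 = (Real.sqrt (1 / y) ^ 2) ^ 2 by ring, hs]
    exact mul_le_of_le_one_right (by positivity)
      (pow_le_one₀ (theta4_pos hy').le (theta4_le_one hy'))
  have h4 : 1 / y * Real.exp (-(Real.pi / (2 * y))) ≤ theta4 y ^ 2 := by
    rw [e4, mul_pow, hs]
    have := theta2_ge hy'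
    have h5 : Real.exp (-(Real.pi / (2 * y))) = Real.exp (-Real.pi * (1 / y) / 4) ^ 2 := by
      rw [← Real.exp_nat_mul]; congr 1; push_cast; field_simp; norm_num
    rw [h5]
    gcongr
  calc theta2 y ^ 4 / theta4 y ^ 2 / nome y ^ m
      ≤ (1 / y) ^ 2 / (1 / y * Real.exp (-(Real.pi / (2 * y)))) / nome y ^ m := by
        have := nome_pos y
        gcongr
    _ = 1 / y * Real.exp (Real.pi / (2 * y) + Real.pi * m * y) := by
        rw [nome_pow, Real.exp_add, Real.exp_neg,
          show -Real.pi * y * (m : ℝ) = -(Real.pi * m * y) by ring, Real.exp_neg]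
        field_simp

/-! ### The Mellin transform of `θ₃²` -/

open Asymptotics in
lemma isBigO_theta3_sub_one : ∃ p : ℝ, 0 < p ∧
    (fun y => theta3 y - 1) =O[atTop] fun y => Real.exp (-p * y) := by
  obtain ⟨p, hp, h⟩ := HurwitzZeta.isBigO_atTop_evenKernel_sub 0
  refine ⟨p, hp, IsBigO.congr' h ?_ EventuallyEq.rfl⟩
  filter_upwards [eventually_gt_atTop 0] with y hy
  rw [theta3_eq_kernel hy, if_pos rfl]

open Asymptotics in
lemma isBigO_theta4_sub_one : ∃ p : ℝ, 0 < p ∧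
    (fun y => theta4 y - 1) =O[atTop] fun y => Real.exp (-p * y) := by
  obtain ⟨p, hp, h⟩ := HurwitzZeta.isBigO_atTop_cosKernel_sub ((1 / 2 : ℝ) : UnitAddCircle)
  refine ⟨p, hp, IsBigO.congr' h ?_ EventuallyEq.rfl⟩
  filter_upwards [eventually_gt_atTop 0] with y hy
  rw [theta4_eq_kernel hy]

open Asymptotics in
lemma tendsto_one_of_isBigO_exp {f : ℝ → ℝ} {p : ℝ} (hp : 0 < p)
    (h : (fun y => f y - 1) =O[atTop] fun y => Real.exp (-p * y)) : Tendsto f atTop (𝓝 1) := by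
  have h0 : Tendsto (fun y : ℝ => Real.exp (-p * y)) atTop (𝓝 0) := by
    refine Real.tendsto_exp_atBot.comp ?_
    exact tendsto_id.const_mul_atTop_of_neg (neg_neg_of_pos hp)
  have := (h.trans_tendsto h0).add_const 1
  simpa using this

lemma tendsto_theta3 : Tendsto theta3 atTop (𝓝 1) :=
  let ⟨_, hp, h⟩ := isBigO_theta3_sub_one
  tendsto_one_of_isBigO_exp hp h

lemma tendsto_theta4 : Tendsto theta4 atTop (𝓝 1) :=
  let ⟨_, hp, h⟩ := isBigO_theta4_sub_one
  tendsto_one_of_isBigO_exp hp h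

open Asymptotics in
/-- If `f - 1` decays rapidly, then so does `f ^ n - 1`. -/
lemma isBigO_pow_sub_one {f : ℝ → ℝ} {g : ℝ → ℝ} (hf : Tendsto f atTop (𝓝 1))
    (h : (fun y => f y - 1) =O[atTop] g) (n : ℕ) : (fun y => f y ^ n - 1) =O[atTop] g := by
  induction n with
  | zero => simpa using isBigO_zero _ _
  | succ n ih =>
    have h1 : (fun y => f y * (f y ^ n - 1)) =O[atTop] g := by
      simpa using (hf.isBigO_one ℝ).mul ih
    refine (h1.add h).congr_left fun y => ?_
    ring

lemma continuousOn_theta3 : ContinuousOn theta3 (Ioi 0) := fun _ hy =>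
  (hasDerivAt_theta3 hy).1.continuousAt.continuousWithinAt

lemma continuousOn_theta3_sq : ContinuousOn (fun y : ℝ => ((theta3 y ^ 2 : ℝ) : ℂ)) (Ioi 0) :=
  Complex.continuous_ofReal.comp_continuousOn (continuousOn_theta3.pow 2)

lemma theta3_sq_inv {y : ℝ} (hy : 0 < y) : theta3 (1 / y) ^ 2 = y * theta3 y ^ 2 := by
  rw [theta3_inv hy, mul_pow, Real.sq_sqrt hy.le]

open Asymptotics in
lemma isBigO_theta3_sq_sub_one (r : ℝ) :
    (fun y : ℝ => ((theta3 y ^ 2 : ℝ) : ℂ) - 1) =O[atTop] (· ^ r) := by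
  obtain ⟨p, hp, h⟩ := isBigO_theta3_sub_one
  have h1 := (isBigO_pow_sub_one tendsto_theta3 h 2).trans
    (isLittleO_exp_neg_mul_rpow_atTop hp r).isBigO
  refine IsBigO.of_norm_left (h1.norm_left.congr_left fun y => ?_)
  rw [← Complex.norm_real]
  push_cast
  rfl

/-- The functional-equation pair of `θ₃²`. -/
def thetaSqPair : WeakFEPair ℂ where
  f y := ((theta3 y ^ 2 : ℝ) : ℂ)
  g y := ((theta3 y ^ 2 : ℝ) : ℂ)
  k := 1
  ε := 1
  f₀ := 1
  g₀ := 1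
  hf_int := continuousOn_theta3_sq.locallyIntegrableOn measurableSet_Ioi
  hg_int := continuousOn_theta3_sq.locallyIntegrableOn measurableSet_Ioi
  hk := one_pos
  hε := one_ne_zero
  h_feq x hx := by
    rw [theta3_sq_inv hx, Real.rpow_one, one_mul, smul_eq_mul]
    push_cast
    rfl
  hf_top := isBigO_theta3_sq_sub_one
  hg_top := isBigO_theta3_sq_sub_one

lemma thetaSqPair_Λ_eq (s : ℂ) :
    thetaSqPair.Λ s = thetaSqPair.Λ₀ s - 1 / s - 1 / (1 - s) := by
  simp [WeakFEPair.Λ, thetaSqPair]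

lemma hasSum_sumTwoSqCount {y : ℝ} (hy : 0 < y) :
    HasSum (fun n : ℕ => (sumTwoSqCount n : ℝ) * nome y ^ n) (theta3 y ^ 2) := by
  let g : ℤ × ℤ → ℕ := fun p => (p.1 ^ 2 + p.2 ^ 2).toNat
  have hg : ∀ p, ((g p : ℕ) : ℤ) = p.1 ^ 2 + p.2 ^ 2 := fun p => Int.toNat_of_nonneg (by positivity)
  refine ((hasSum_theta3_sq hy).tsum_fiberwise g).congr_fun fun n => ?_
  have h1 : ∀ b : ↥(g ⁻¹' {n}), Real.exp (-Real.pi * y * (((b : ℤ × ℤ).1 : ℝ) ^ 2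
      + ((b : ℤ × ℤ).2 : ℝ) ^ 2)) = nome y ^ n := by
    rintro ⟨p, hp⟩
    rw [nome_pow]
    congr 2
    have h2 := hg p
    rw [show g p = n from hp] at h2
    exact_mod_cast h2.symm
  rw [tsum_congr h1, tsum_const, nsmul_eq_mul]
  congr 1
  have hinj : Function.Injective fun p : ℤ × ℤ => (⟨p.1, p.2⟩ : GaussianInt) := by
    rintro ⟨a, b⟩ ⟨c, d⟩ h
    simpa [Zsqrtd.ext_iff] using h
  have himg : gaussSphere n = (fun p : ℤ × ℤ => (⟨p.1, p.2⟩ : GaussianInt)) '' (g ⁻¹' {n}) := by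
    ext z
    rw [mem_gaussSphere, Zsqrtd.norm_def]
    constructor
    · intro h
      refine ⟨(z.re, z.im), ?_, rfl⟩
      have := hg (z.re, z.im)
      rw [Set.mem_preimage, Set.mem_singleton_iff]
      zify
      rw [this, ← h]
      ring
    · rintro ⟨p, hp, rfl⟩
      have := hg p
      rw [show g p = n from hp] at this
      rw [this]
      ring
  rw [sumTwoSqCount, himg, Set.ncard_image_of_injective _ hinj, Int.cast_natCast]
  rfl

lemma sumTwoSqCount_zero : sumTwoSqCount 0 = 1 := by
  rw [sumTwoSqCount, gaussSphere_zero, Set.ncard_singleton]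
  rfl

lemma hasSum_theta3_sq_sub_one {y : ℝ} (hy : 0 < y) :
    HasSum (fun n : ℕ => (sumTwoSqCount (n + 1) : ℝ) * nome y ^ (n + 1)) (theta3 y ^ 2 - 1) := by
  have := (hasSum_nat_add_iff' 1).2 (hasSum_sumTwoSqCount hy)
  simpa [sumTwoSqCount_zero] using this

/-! ### The Dirichlet series of sums of two squares. -/

lemma chi_natCast (n : ℕ) : chi (n : ZMod 4) = (ZMod.χ₄ (n : ZMod 4) : ℂ) := rfl

lemma chi_ne_one : chi ≠ 1 := by
  intro h
  have h1 := congrArg (fun χ : DirichletCharacter ℂ 4 => χ ((3 : ℕ) : ZMod 4)) h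
  have hu : IsUnit ((3 : ℕ) : ZMod 4) := by decide
  rw [chi_natCast, MulChar.one_apply hu] at h1
  have h2 : ZMod.χ₄ ((3 : ℕ) : ZMod 4) = -1 := by decide
  rw [h2] at h1
  norm_num at h1

lemma zetaMul_chi_eq {n : ℕ} (hn : n ≠ 0) :
    4 * DirichletCharacter.zetaMul chi n = (sumTwoSqCount n : ℂ) := by
  rw [sumTwoSqCount_eq hn, DirichletCharacter.zetaMul, ArithmeticFunction.coe_zeta_mul_apply,
    chiDivisorSum]
  push_cast
  congr 1
  refine Finset.sum_congr rfl fun d hd => ?_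
  have : d ≠ 0 := (Nat.pos_of_mem_divisors hd).ne'
  simp only [toArithmeticFunction, ArithmeticFunction.coe_mk, if_neg this]
  rfl

lemma LSeries_zetaMul_chi {s : ℂ} (hs : 1 < s.re) :
    LSeries (DirichletCharacter.zetaMul chi) s = riemannZeta s * chi.LFunction s := by
  have h1 : LSeriesSummable (fun n => ((ArithmeticFunction.zeta : ArithmeticFunction ℂ)) n) s :=
    ArithmeticFunction.LSeriesSummable_zeta_iff.mpr hs
  have h2 : LSeriesSummable (fun n => toArithmeticFunction (fun n : ℕ => chi (n : ZMod 4)) n) s :=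
    LSeriesSummable_of_bounded_of_one_lt_re (m := 1) (fun n hn ↦ by
      simpa only [toArithmeticFunction, ArithmeticFunction.coe_mk, hn, ↓reduceIte]
        using DirichletCharacter.norm_le_one chi _) hs
  rw [DirichletCharacter.zetaMul, ArithmeticFunction.LSeries_mul' h1 h2,
    DirichletCharacter.LFunction_eq_LSeries chi hs,
    ← ArithmeticFunction.LSeries_zeta_eq_riemannZeta hs]
  congr 1
  refine LSeries_congr (fun {n} hn => ?_) s
  simp [toArithmeticFunction, hn]

/-- Termwise Mellin transform of θ₃² - 1 = ∑ r₂(n) e^(-πny); by the two-square theorem ∑ r₂(n)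
n^(-s) = 4ζ(s)L(s,χ). -/
lemma thetaSqPair_Λ_of_one_lt {s : ℂ} (hs : 1 < s.re) : thetaSqPair.Λ s = 4 * zetaProduct s := by
  have hs0 : 0 < s.re := one_pos.trans hs
  have hsum := (DirichletCharacter.LSeriesSummable_zetaMul chi hs)
  have hL : HasSum (fun n : ℕ => (sumTwoSqCount (n + 1) : ℂ) / ((n + 1 : ℕ) : ℂ) ^ s)
      (4 * (riemannZeta s * chi.LFunction s)) := by
    have h1 := (hsum.LSeriesHasSum.mul_left 4)
    rw [LSeries_zetaMul_chi hs] at h1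
    have h2 := (hasSum_nat_add_iff' 1).2 h1
    simp only [Finset.sum_range_one, LSeries.term_zero, mul_zero, sub_zero] at h2
    refine h2.congr_fun fun n => ?_
    rw [LSeries.term_of_ne_zero n.succ_ne_zero, ← zetaMul_chi_eq n.succ_ne_zero, mul_div_assoc]
  have hM := hasSum_mellin_pi_mul (a := fun n : ℕ => (sumTwoSqCount (n + 1) : ℂ))
    (q := fun n : ℕ => ((n + 1 : ℕ) : ℝ)) (F := fun y => ((theta3 y ^ 2 : ℝ) : ℂ) - 1) (s := s)
    (fun n => Or.inr (by positivity)) hs0 ?_ ?_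
  · have h3 := (thetaSqPair.hasMellin (s := s) hs).2
    rw [← h3]
    change mellin (fun y => ((theta3 y ^ 2 : ℝ) : ℂ) - 1) s = _
    refine hM.unique ?_
    have h4 := hL.mul_left ((Real.pi : ℂ) ^ (-s) * Complex.Gamma s)
    rw [zetaProduct, show 4 * ((Real.pi : ℂ) ^ (-s) * Complex.Gamma s * riemannZeta s * chi.LFunction s)
      = (Real.pi : ℂ) ^ (-s) * Complex.Gamma s * (4 * (riemannZeta s * chi.LFunction s)) by ring]
    refine h4.congr_fun fun n => ?_
    rw [Complex.ofReal_natCast, mul_div_assoc]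
  · intro t ht
    have h5 := Complex.hasSum_ofReal.2 (hasSum_theta3_sq_sub_one ht)
    rw [Complex.ofReal_sub, Complex.ofReal_one] at h5
    refine h5.congr_fun fun n => ?_
    rw [nome_pow]
    push_cast
    ring_nf
  · refine hL.summable.norm.congr fun n => ?_
    rw [norm_div, Complex.norm_natCast_cpow_of_pos n.succ_pos]

/-! ### Analytic continuation and the removable singularities. -/

/-- The poles of the factors of `zetaProduct`. -/
def poleSet : Set ℂ := {1} ∪ range fun n : ℕ => -(n : ℂ)

lemma notMem_poleSet {s : ℂ} : s ∉ poleSet ↔ s ≠ 1 ∧ ∀ n : ℕ, s ≠ -(n : ℂ) := by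
  simp only [poleSet, mem_union, mem_singleton_iff, mem_range, not_or, not_exists]
  exact and_congr_right fun _ => forall_congr' fun _ => ⟨Ne.symm, Ne.symm⟩

lemma poleSet_countable : poleSet.Countable := (countable_singleton _).union (countable_range _)

lemma poleSet_subset_range_intCast : poleSet ⊆ range ((↑) : ℤ → ℂ) := by
  rintro _ (rfl | ⟨n, rfl⟩)
  · exact ⟨1, by simp⟩
  · exact ⟨-n, by simp⟩

lemma isClosed_of_subset_range_intCast {S : Set ℂ} (hS : S ⊆ range ((↑) : ℤ → ℂ)) :
    IsClosed S := by
  have : S = ((↑) : ℤ → ℂ) '' (((↑) : ℤ → ℂ) ⁻¹' S) := (image_preimage_eq_of_subset hS).symm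
  rw [this]
  exact Complex.isClosedEmbedding_intCast.isClosedMap _ (isClosed_discrete _)

lemma eventually_notMem_poleSet (x : ℂ) : ∀ᶠ z in 𝓝[≠] x, z ∉ poleSet := by
  have h : IsClosed (poleSet \ {x}) :=
    isClosed_of_subset_range_intCast (sdiff_subset.trans poleSet_subset_range_intCast)
  have h2 := h.isOpen_compl.mem_nhds (show x ∈ (poleSet \ {x})ᶜ by simp)
  filter_upwards [nhdsWithin_le_nhds h2, self_mem_nhdsWithin] with z hz hne hmem
  exact hz ⟨hmem, hne⟩

lemma differentiableAt_zetaProduct {s : ℂ} (hs : s ∉ poleSet) :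
    DifferentiableAt ℂ zetaProduct s := by
  rw [notMem_poleSet] at hs
  have hpi : (Real.pi : ℂ) ≠ 0 := Complex.ofReal_ne_zero.2 Real.pi_ne_zero
  refine DifferentiableAt.mul (DifferentiableAt.mul (DifferentiableAt.mul ?_ ?_) ?_) ?_
  · exact (differentiableAt_id.neg).const_cpow (Or.inl hpi)
  · exact Complex.differentiableAt_Gamma _ hs.2
  · exact differentiableAt_riemannZeta hs.1
  · exact DirichletCharacter.differentiable_LFunction chi_ne_one s

lemma analyticAt_thetaSqPair_Λ {s : ℂ} (h0 : s ≠ 0) (h1 : s ≠ 1) :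
    AnalyticAt ℂ thetaSqPair.Λ s := by
  have ho : IsOpen (({0, 1} : Set ℂ)ᶜ) := (Set.toFinite _).isClosed.isOpen_compl
  have hd : DifferentiableOn ℂ thetaSqPair.Λ (({0, 1} : Set ℂ)ᶜ) := by
    intro z hz
    simp only [mem_compl_iff, mem_insert_iff, mem_singleton_iff, not_or] at hz
    refine (thetaSqPair.differentiableAt_Λ (Or.inl hz.1) (Or.inl ?_)).differentiableWithinAt
    simpa [thetaSqPair] using hz.2
  exact hd.analyticAt (ho.mem_nhds (by simp [h0, h1]))

/-- Identity theorem on the complement of a closed countable set, which is connected, starting from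
a neighbourhood of 2. -/
lemma thetaSqPair_Λ_eq_zetaProduct {s : ℂ} (hs : s ∉ poleSet) :
    thetaSqPair.Λ s = 4 * zetaProduct s := by
  have hopen : IsOpen poleSetᶜ :=
    (isClosed_of_subset_range_intCast poleSet_subset_range_intCast).isOpen_compl
  have hconn : IsPreconnected poleSetᶜ :=
    (poleSet_countable.isConnected_compl_of_one_lt_rank
      (by rw [Complex.rank_real_complex]; norm_num)).isPreconnected
  have hf : AnalyticOnNhd ℂ thetaSqPair.Λ poleSetᶜ := by
    intro z hz
    have := notMem_poleSet.1 hz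
    exact analyticAt_thetaSqPair_Λ (by simpa using this.2 0) this.1
  have hg : AnalyticOnNhd ℂ (fun z => 4 * zetaProduct z) poleSetᶜ :=
    DifferentiableOn.analyticOnNhd (fun z hz =>
      ((differentiableAt_zetaProduct hz).const_mul 4).differentiableWithinAt) hopen
  have h2 : (2 : ℂ) ∈ poleSetᶜ := by
    rw [mem_compl_iff, notMem_poleSet]
    refine ⟨by norm_num, fun n h => ?_⟩
    have := congrArg Complex.re h
    simp at this
    linarith [Nat.cast_nonneg (α := ℝ) n]
  refine hf.eqOn_of_preconnected_of_eventuallyEq hg hconn h2 ?_ hs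
  have : ∀ᶠ z : ℂ in 𝓝 2, 1 < z.re :=
    Complex.continuous_re.continuousAt.eventually_const_lt (by norm_num)
  filter_upwards [this] with z hz using thetaSqPair_Λ_of_one_lt hz

lemma zetaProduct_eventuallyEq (x : ℂ) :
    zetaProduct =ᶠ[𝓝[≠] x] fun s => thetaSqPair.Λ s / 4 := by
  filter_upwards [eventually_notMem_poleSet x] with z hz
  rw [thetaSqPair_Λ_eq_zetaProduct hz]
  ring

lemma meromorphicOn_zetaProduct : MeromorphicOn zetaProduct univ := by
  intro x _
  have h0 : MeromorphicAt thetaSqPair.Λ₀ x :=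
    (thetaSqPair.differentiable_Λ₀.analyticAt x).meromorphicAt
  have h1 : MeromorphicAt (fun s : ℂ => 1 / s) x := by fun_prop
  have h2 : MeromorphicAt (fun s : ℂ => 1 / (1 - s)) x := by fun_prop
  have h3 : MeromorphicAt (fun s => thetaSqPair.Λ s / 4) x := by
    have := ((h0.sub h1).sub h2).mul (MeromorphicAt.const (4⁻¹ : ℂ) x)
    refine this.congr (Eventually.of_forall fun s => ?_)
    change (thetaSqPair.Λ₀ s - 1 / s - 1 / (1 - s)) * 4⁻¹ = thetaSqPair.Λ s / 4
    rw [thetaSqPair_Λ_eq]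
    ring
  exact h3.congr (zetaProduct_eventuallyEq x).symm

/-- Functions in meromorphic normal form that agree on a punctured neighbourhood agree at the point.
This covers the negative integers, where the raw product only has a default value of Γ. -/
theorem zetaStar2_eq_Λ {s : ℂ} (h0 : s ≠ 0) (h1 : s ≠ 1) : zetaStar2 s = thetaSqPair.Λ s / 4 := by
  have hNF : MeromorphicNFAt zetaStar2 s :=
    meromorphicNFOn_toMeromorphicNFOn zetaProduct univ (mem_univ s)
  have hA : AnalyticAt ℂ (fun s => thetaSqPair.Λ s / 4) s :=
    (analyticAt_thetaSqPair_Λ h0 h1).div_const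
  have h := (meromorphicOn_zetaProduct.toMeromorphicNFOn_eq_self_on_nhdsNE (mem_univ s)).trans
    (zetaProduct_eventuallyEq s)
  exact ((hNF.eventuallyEq_nhdsNE_iff_eventuallyEq_nhds hA.meromorphicNFAt).1 h).eq_of_nhds

theorem zetaStar2_eq_zetaProduct {s : ℂ} (h1 : s ≠ 1) (h : ∀ n : ℕ, s ≠ -(n : ℂ)) :
    zetaStar2 s = zetaProduct s := by
  rw [zetaStar2_eq_Λ (by simpa using h 0) h1, thetaSqPair_Λ_eq_zetaProduct (notMem_poleSet.2 ⟨h1, h⟩)]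
  ring

/-- `f_modif` subtracts only 1/y on (0,1) and only 1 on (1,∞). The missing pieces, 1 on (0,1] and
1/y on (1,∞), have Mellin transforms 1/s and 1/(1-s) exactly in the strip; these are the polar terms
of Λ. -/
theorem hasMellin_strip {s : ℂ} (hs0 : 0 < s.re) (hs1 : s.re < 1) :
    IntegrableOn (fun y : ℝ => (y : ℂ) ^ (s - 1) * ((theta3 y ^ 2 - 1 - 1 / y : ℝ) : ℂ)) (Ioi 0) ∧
      ∫ y in Ioi (0 : ℝ), (y : ℂ) ^ (s - 1) * ((theta3 y ^ 2 - 1 - 1 / y : ℝ) : ℂ)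
        = thetaSqPair.Λ s := by
  have hm := thetaSqPair.isStrongFEPair_toStrongFEPair.hasMellin s
  have h1 : IntegrableOn (fun y : ℝ => (y : ℂ) ^ (s - 1) • thetaSqPair.f_modif y) (Ioi 0) := hm.1
  have hM := hasMellin_one_Ioc hs0
  have h2 : IntegrableOn (fun y : ℝ => (y : ℂ) ^ (s - 1) •
    indicator (Ioc 0 1) (fun _ => 1 : ℝ → ℂ) y) (Ioi 0) := hM.1
  have hre : (s - 2).re < -1 := by simp; linarith
  have h3 : IntegrableOn (indicator (Ioi 1) fun y : ℝ => (y : ℂ) ^ (s - 2)) (Ioi 0) :=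
    ((integrable_indicator_iff measurableSet_Ioi).2
      (integrableOn_Ioi_cpow_of_lt hre one_pos)).integrableOn
  have e3 : ∫ y in Ioi (0 : ℝ), indicator (Ioi 1) (fun y : ℝ => (y : ℂ) ^ (s - 2)) y
      = 1 / (1 - s) := by
    rw [setIntegral_indicator measurableSet_Ioi, Ioi_inter_Ioi, max_eq_right zero_le_one,
      integral_Ioi_cpow_of_lt hre one_pos]
    have : s - 2 + 1 = -(1 - s) := by ring
    rw [Complex.ofReal_one, Complex.one_cpow, this, neg_div_neg_eq]
  have hae : (fun y : ℝ => (y : ℂ) ^ (s - 1) • thetaSqPair.f_modif y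
      - (y : ℂ) ^ (s - 1) • indicator (Ioc 0 1) (fun _ => 1 : ℝ → ℂ) y
      - indicator (Ioi 1) (fun y : ℝ => (y : ℂ) ^ (s - 2)) y)
      =ᵐ[volume.restrict (Ioi 0)]
      fun y : ℝ => (y : ℂ) ^ (s - 1) * ((theta3 y ^ 2 - 1 - 1 / y : ℝ) : ℂ) := by
    rw [EventuallyEq, ae_restrict_iff' measurableSet_Ioi]
    filter_upwards [compl_mem_ae_iff.mpr (Subsingleton.measure_zero (s := {(1 : ℝ)}) (by simp) _)]
      with y (hy1 : y ≠ 1) (hy0 : 0 < y)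
    have hyc : (y : ℂ) ≠ 0 := Complex.ofReal_ne_zero.2 hy0.ne'
    rcases lt_or_gt_of_ne hy1 with hlt | hgt
    · rw [WeakFEPair.f_modif, Pi.add_apply, indicator_of_notMem (by simpa using hlt.le),
        indicator_of_mem (show y ∈ Ioo 0 1 from ⟨hy0, hlt⟩), indicator_of_mem (show y ∈ Ioc 0 1 from ⟨hy0, hlt.le⟩),
        indicator_of_notMem (by simpa using hlt.le)]
      simp only [thetaSqPair, Real.rpow_neg hy0.le, Real.rpow_one, smul_eq_mul]
      push_cast
      ring
    · rw [WeakFEPair.f_modif, Pi.add_apply, indicator_of_mem (by simpa using hgt),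
        indicator_of_notMem (by simp [hgt.le]), indicator_of_notMem (by simp [hgt]),
        indicator_of_mem (by simpa using hgt)]
      have e : (y : ℂ) ^ (s - 2) = (y : ℂ) ^ (s - 1) * (1 / y) := by
        rw [show s - 2 = s - 1 - 1 by ring, Complex.cpow_sub _ 1 hyc, Complex.cpow_one]
        ring
      simp only [thetaSqPair, smul_eq_mul, e]
      push_cast
      ring
  refine ⟨((h1.sub h2).sub h3).congr hae, ?_⟩
  have h12 : IntegrableOn (fun y : ℝ => (y : ℂ) ^ (s - 1) • thetaSqPair.f_modif y
      - (y : ℂ) ^ (s - 1) • indicator (Ioc 0 1) (fun _ => 1 : ℝ → ℂ) y) (Ioi 0) := h1.sub h2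
  rw [← integral_congr_ae hae, integral_sub h12 h3, integral_sub h1 h2, e3]
  have e1 : ∫ y in Ioi (0 : ℝ), (y : ℂ) ^ (s - 1) • thetaSqPair.f_modif y = thetaSqPair.Λ₀ s := rfl
  have e2 : ∫ y in Ioi (0 : ℝ), (y : ℂ) ^ (s - 1) • indicator (Ioc 0 1) (fun _ => 1 : ℝ → ℂ) y
    = 1 / s := hM.2
  rw [e1, e2, thetaSqPair_Λ_eq]

/-! ### The Bessel series as a Mellin transform -/

/-- Regroups a double series over positive d, m by the product j = dm; it is applied both to the
terms and to their norms. -/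
lemma hasSum_divisors_of_prod {E : Type*} [NormedAddCommGroup E] {f : ℕ → ℕ → E} {S : E}
    (h : HasSum (fun p : ℕ × ℕ => f (p.1 + 1) (p.2 + 1)) S) :
    HasSum (fun j : ℕ => ∑ d ∈ (j + 1).divisors, f d ((j + 1) / d)) S := by
  have h1 : HasSum (fun p : ℕ+ × ℕ+ => f p.1 p.2) S := by
    refine ((Equiv.pnatEquivNat.prodCongr Equiv.pnatEquivNat).hasSum_iff.2 h).congr_fun fun p => ?_
    simp [Equiv.pnatEquivNat, PNat.natPred_add_one]
  have h2 := (sigmaAntidiagonalEquivProd.hasSum_iff.2 h1).sigma fun n => hasSum_fintype _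
  refine (Equiv.pnatEquivNat.symm.hasSum_iff.2 h2).congr_fun fun j => ?_
  have h3 : ((Equiv.pnatEquivNat.symm j : ℕ+) : ℕ) = j + 1 := rfl
  simp only [Function.comp_apply, sigmaAntidiagonalEquivProd]
  rw [← Nat.sum_divisorsAntidiagonal (fun x y => f x y), ← h3]
  exact (Finset.sum_coe_sort _ (fun x : ℕ × ℕ => f x.1 x.2)).symm

/-- The weight that dominates the terms of the double series. -/
def expWeight (y : ℝ) : ℝ := y⁻¹ * Real.exp (-(y + y⁻¹) / 4)

lemma exp_neg_div_four_le {y : ℝ} (hy : 0 < y) (n : ℕ) :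
    Real.exp (-y / 4) ≤ n.factorial * 4 ^ n * (y ^ n)⁻¹ := by
  have h := Real.pow_div_factorial_le_exp (y / 4) (by positivity) n
  rw [neg_div, Real.exp_neg]
  refine (inv_anti₀ (by positivity) h).trans_eq ?_
  rw [div_pow]
  field_simp

lemma expWeight_nonneg {y : ℝ} (hy : 0 < y) : 0 ≤ expWeight y := by
  unfold expWeight
  positivity

/-- Carries the rapid decay at infinity over to 0. Decay at both ends makes every Mellin transform
below entire. -/
lemma expWeight_inv {y : ℝ} (hy : 0 < y) : expWeight y = y⁻¹ ^ 2 * expWeight y⁻¹ := by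
  unfold expWeight
  rw [inv_inv, add_comm y⁻¹ y]
  field_simp

lemma expWeight_le {y : ℝ} (hy : 0 < y) (n : ℕ) :
    expWeight y ≤ n.factorial * 4 ^ n * (y ^ (n + 1))⁻¹ := by
  have h1 : Real.exp (-(y + y⁻¹) / 4) ≤ Real.exp (-y / 4) := by
    have := inv_pos.2 hy
    gcongr
    linarith
  calc expWeight y ≤ y⁻¹ * (n.factorial * 4 ^ n * (y ^ n)⁻¹) := by
        unfold expWeight
        gcongr
        exact h1.trans (exp_neg_div_four_le hy n)
    _ = _ := by rw [pow_succ, mul_inv]; ring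

lemma expWeight_le' {y : ℝ} (hy : 0 < y) (n : ℕ) :
    expWeight y ≤ (n + 1).factorial * 4 ^ (n + 1) * y ^ n := by
  rw [expWeight_inv hy]
  calc _ ≤ y⁻¹ ^ 2 * ((n + 1).factorial * 4 ^ (n + 1) * (y⁻¹ ^ (n + 1 + 1))⁻¹) := by
        gcongr
        exact expWeight_le (inv_pos.2 hy) (n + 1)
    _ = _ := by
        rw [inv_pow y (n + 1 + 1), inv_inv]
        field_simp
        ring

lemma expWeight_le_four {y : ℝ} (hy : 0 < y) : expWeight y ≤ 4 := by
  simpa using expWeight_le' hy 0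

open Asymptotics in
lemma isBigO_atTop_of_le_expWeight {E : Type*} [NormedAddCommGroup E] {f : ℝ → E} {c : ℝ}
    (hf : ∀ y, 0 < y → ‖f y‖ ≤ c * expWeight y) (n : ℕ) :
    f =O[atTop] fun y : ℝ => y ^ (-(n : ℝ)) := by
  refine IsBigO.of_bound (|c| * (n.factorial * 4 ^ n)) ?_
  filter_upwards [eventually_ge_atTop 1] with y hy
  have hy0 : 0 < y := by linarith
  rw [Real.rpow_neg hy0.le, Real.rpow_natCast, norm_inv, norm_pow, Real.norm_of_nonneg hy0.le,
    mul_assoc]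
  refine (hf y hy0).trans (mul_le_mul (le_abs_self c) ((expWeight_le hy0 n).trans ?_)
    (expWeight_nonneg hy0) (abs_nonneg c))
  gcongr
  exact n.le_succ

open Asymptotics in
lemma isBigO_zero_of_le_expWeight {E : Type*} [NormedAddCommGroup E] {f : ℝ → E} {c : ℝ}
    (hf : ∀ y, 0 < y → ‖f y‖ ≤ c * expWeight y) (n : ℕ) :
    f =O[𝓝[>] 0] fun y : ℝ => y ^ (-(-(n : ℝ))) := by
  refine IsBigO.of_bound (|c| * ((n + 1).factorial * 4 ^ (n + 1))) ?_
  filter_upwards [self_mem_nhdsWithin] with y hy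
  have hy0 : 0 < y := hy
  rw [neg_neg, Real.rpow_natCast, norm_pow, Real.norm_of_nonneg hy0.le, mul_assoc]
  exact (hf y hy0).trans (mul_le_mul (le_abs_self c) (expWeight_le' hy0 n)
    (expWeight_nonneg hy0) (abs_nonneg c))

lemma mellinConvergent_of_le_expWeight {f : ℝ → ℂ} {c : ℝ} (hcont : ContinuousOn f (Ioi 0))
    (hf : ∀ y, 0 < y → ‖f y‖ ≤ c * expWeight y) (s : ℂ) : MellinConvergent f s := by
  obtain ⟨n, hn⟩ := exists_nat_gt s.re
  obtain ⟨k, hk⟩ := exists_nat_gt (-s.re)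
  exact mellinConvergent_of_isBigO_rpow (hcont.locallyIntegrableOn measurableSet_Ioi)
    (isBigO_atTop_of_le_expWeight hf n) hn (isBigO_zero_of_le_expWeight hf k) (by linarith)

lemma differentiable_mellin_of_le_expWeight {f : ℝ → ℂ} {c : ℝ} (hcont : ContinuousOn f (Ioi 0))
    (hf : ∀ y, 0 < y → ‖f y‖ ≤ c * expWeight y) : Differentiable ℂ (mellin f) := by
  intro s
  obtain ⟨n, hn⟩ := exists_nat_gt s.re
  obtain ⟨k, hk⟩ := exists_nat_gt (-s.re)
  exact mellin_differentiableAt_of_isBigO_rpow (hcont.locallyIntegrableOn measurableSet_Ioi)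
    (isBigO_atTop_of_le_expWeight hf n) hn (isBigO_zero_of_le_expWeight hf k) (by linarith)

/-- The kernel `exp (-π (d y + m / y))`. -/
def besselKernel (d m : ℕ) (y : ℝ) : ℝ := Real.exp (-Real.pi * (d * y + m / y))

/-- The terms of the product of the expansions of `4 θ₄'/θ₄ - 2 θ₃'/θ₃` at `y` and of
`θ₂⁴/θ₃²` at `1/y`. -/
def doubleTerm (d m : ℕ) (y : ℝ) : ℝ := Real.pi * (a2 d * b2 m) * besselKernel d m y

lemma abs_doubleTerm_le {d m : ℕ} (hd : d ≠ 0) (hm : m ≠ 0) {y : ℝ} (hy : 0 < y) :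
    |doubleTerm d m y| ≤ 49152 * Real.pi * ((d : ℝ) ^ 2)⁻¹ * ((m : ℝ) ^ 2)⁻¹ * expWeight y := by
  have hpi := Real.pi_gt_three
  have hd1 : (1 : ℝ) ≤ d := by exact_mod_cast Nat.one_le_iff_ne_zero.2 hd
  have hm1 : (1 : ℝ) ≤ m := by exact_mod_cast Nat.one_le_iff_ne_zero.2 hm
  -- On this circle the bound for b₂ costs exp(π(2y/3 + 3m/(4y))). As 2/3 < 1 ≤ d and 3/4 < 1, the
  -- kernel still wins, and π > 3 leaves room for the three exponentials below.
  have hb := abs_b2_le (y := 3 / 4 / y) (by positivity) m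
  have hiy := inv_pos.2 hy
  have hexp : Real.exp (Real.pi / (2 * (3 / 4 / y)) + Real.pi * m * (3 / 4 / y))
      * besselKernel d m y ≤ Real.exp (-(d * y) / 2) * Real.exp (-(m * y⁻¹) / 2)
        * Real.exp (-(y + y⁻¹) / 4) := by
    unfold besselKernel
    rw [← Real.exp_add, ← Real.exp_add, ← Real.exp_add, Real.exp_le_exp]
    have e1 : Real.pi / (2 * (3 / 4 / y)) + Real.pi * m * (3 / 4 / y)
        + -Real.pi * (d * y + m / y) = -(Real.pi * ((d - 2 / 3) * y + m * y⁻¹ / 4)) := by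
      field_simp
      ring
    rw [e1]
    have h1 : y ≤ d * y := le_mul_of_one_le_left hy.le hd1
    have h2 : y⁻¹ ≤ m * y⁻¹ := le_mul_of_one_le_left hiy.le hm1
    have h3 : 3 * ((d - 2 / 3) * y + m * y⁻¹ / 4) ≤ Real.pi * ((d - 2 / 3) * y + m * y⁻¹ / 4) := by
      have : 0 ≤ (d - 2 / 3) * y + m * y⁻¹ / 4 := by
        have : (0 : ℝ) ≤ d - 2 / 3 := by linarith
        positivity
      gcongr
    nlinarith
  -- The powers 4 and 2 turn the prefactor d²y into d⁻²m⁻²y⁻¹: summable in d and m, with the y⁻¹ of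
  -- `expWeight`. The constants are 4!·2⁴ = 384 and 2!·2² = 8.
  have e1 : Real.exp (-(d * y) / 2) ≤ 384 * (((d : ℝ) * y) ^ 4)⁻¹ := by
    have h := Real.pow_div_factorial_le_exp (d * y / 2) (by positivity) 4
    rw [neg_div, Real.exp_neg]
    refine (inv_anti₀ (by positivity) h).trans_eq ?_
    norm_num [Nat.factorial]
    field_simp
    norm_num
  have e2 : Real.exp (-(m * y⁻¹) / 2) ≤ 8 * (((m : ℝ) * y⁻¹) ^ 2)⁻¹ := by
    have h := Real.pow_div_factorial_le_exp (m * y⁻¹ / 2) (by positivity) 2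
    rw [neg_div, Real.exp_neg]
    refine (inv_anti₀ (by positivity) h).trans_eq ?_
    norm_num [Nat.factorial]
    field_simp
    norm_num
  have hk : 0 ≤ besselKernel d m y := (Real.exp_pos _).le
  calc |doubleTerm d m y| = Real.pi * (|a2 d| * |b2 m|) * besselKernel d m y := by
        rw [doubleTerm, abs_mul, abs_mul, abs_mul, abs_of_nonneg hk, abs_of_pos Real.pi_pos]
    _ ≤ Real.pi * ((12 * (d : ℝ) ^ 2) * (1 / (3 / 4 / y) *
          Real.exp (Real.pi / (2 * (3 / 4 / y)) + Real.pi * m * (3 / 4 / y))))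
          * besselKernel d m y := by
        gcongr
        exact abs_a2_le hd
    _ = 16 * Real.pi * d ^ 2 * y * (Real.exp (Real.pi / (2 * (3 / 4 / y))
          + Real.pi * m * (3 / 4 / y)) * besselKernel d m y) := by
        field_simp
        ring
    _ ≤ 16 * Real.pi * d ^ 2 * y * ((384 * (((d : ℝ) * y) ^ 4)⁻¹)
          * (8 * (((m : ℝ) * y⁻¹) ^ 2)⁻¹) * Real.exp (-(y + y⁻¹) / 4)) := by
        exact mul_le_mul_of_nonneg_left (hexp.trans (by gcongr)) (by positivity)
    _ = _ := by
        unfold expWeight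
        field_simp
        ring

lemma summable_inv_sq_prod :
    Summable fun p : ℕ × ℕ => (((p.1 + 1 : ℕ) : ℝ) ^ 2)⁻¹ * (((p.2 + 1 : ℕ) : ℝ) ^ 2)⁻¹ := by
  have h : Summable fun n : ℕ => (((n + 1 : ℕ) : ℝ) ^ 2)⁻¹ :=
    (summable_nat_add_iff (f := fun n : ℕ => ((n : ℝ) ^ 2)⁻¹) 1).2
      (Real.summable_nat_pow_inv.2 one_lt_two)
  exact h.mul_of_nonneg h (fun n => by positivity) fun n => by positivity

/-- The constants that dominate the terms of the double series. -/
def termBound (p : ℕ × ℕ) : ℝ :=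
  49152 * Real.pi * ((((p.1 + 1 : ℕ) : ℝ) ^ 2)⁻¹ * (((p.2 + 1 : ℕ) : ℝ) ^ 2)⁻¹)

lemma termBound_nonneg (p : ℕ × ℕ) : 0 ≤ termBound p := by
  unfold termBound
  positivity

lemma summable_termBound : Summable termBound := summable_inv_sq_prod.mul_left _

lemma abs_doubleTerm_le_termBound (p : ℕ × ℕ) {y : ℝ} (hy : 0 < y) :
    |doubleTerm (p.1 + 1) (p.2 + 1) y| ≤ termBound p * expWeight y := by
  refine (abs_doubleTerm_le p.1.succ_ne_zero p.2.succ_ne_zero hy).trans_eq ?_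
  simp only [termBound, mul_assoc]

/-- `y` times the derivative of `θ₄⁴/θ₃²`. -/
def psiKernel (y : ℝ) : ℝ := ∑' p : ℕ × ℕ, doubleTerm (p.1 + 1) (p.2 + 1) y

lemma summable_abs_doubleTerm {y : ℝ} (hy : 0 < y) :
    Summable fun p : ℕ × ℕ => |doubleTerm (p.1 + 1) (p.2 + 1) y| :=
  .of_nonneg_of_le (fun _ => abs_nonneg _) (fun p => abs_doubleTerm_le_termBound p hy)
    (summable_termBound.mul_right _)

lemma abs_psiKernel_le {y : ℝ} (hy : 0 < y) :
    |psiKernel y| ≤ (∑' p, termBound p) * expWeight y :=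
  tsum_of_norm_bounded (f := fun p : ℕ × ℕ => doubleTerm (p.1 + 1) (p.2 + 1) y)
    (summable_termBound.hasSum.mul_right _) fun p => abs_doubleTerm_le_termBound p hy

lemma continuousOn_doubleTerm (d m : ℕ) : ContinuousOn (doubleTerm d m) (Ioi 0) := by
  unfold doubleTerm besselKernel
  have h : ContinuousOn (fun y : ℝ => (m : ℝ) / y) (Ioi 0) :=
    continuousOn_const.div continuousOn_id fun _ hy => ne_of_gt hy
  fun_prop

lemma continuousOn_psiKernel : ContinuousOn psiKernel (Ioi 0) := by
  refine continuousOn_tsum (fun p => continuousOn_doubleTerm _ _) (summable_termBound.mul_right 4)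
    fun p y hy => (abs_doubleTerm_le_termBound p hy).trans ?_
  exact mul_le_mul_of_nonneg_left (expWeight_le_four hy) (termBound_nonneg p)

/-- The product of the expansion of the logarithmic derivative at y with that of θ₂⁴/θ₃² at 1/y;
inversion rewrites the latter value as yθ₄⁴/θ₃² at y. -/
lemma psiKernel_eq {y : ℝ} (hy : 0 < y) :
    psiKernel y = (4 * (deriv theta4 y / theta4 y) - 2 * (deriv theta3 y / theta3 y))
      * (y * (theta4 y ^ 4 / theta3 y ^ 2)) := by
  have hiy : 0 < 1 / y := by positivity
  have hterm : ∀ p : ℕ × ℕ, doubleTerm (p.1 + 1) (p.2 + 1) y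
      = (Real.pi * (a2 (p.1 + 1) * nome y ^ (p.1 + 1)))
        * (b2 (p.2 + 1) * nome (1 / y) ^ (p.2 + 1)) := by
    intro p
    rw [doubleTerm, besselKernel, nome_pow, nome_pow, mul_add, Real.exp_add]
    ring_nf
  have h := (hasSum_a2 hy).mul (hasSum_b2 hiy)
    ((summable_abs_doubleTerm hy).of_abs.congr hterm)
  rw [psiKernel, tsum_congr hterm, h.tsum_eq, theta2_inv hy, theta3_inv hy]
  congr 1
  have h2 : √y ^ 2 = y := Real.sq_sqrt hy.le
  have h3 := (theta3_pos hy).ne'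
  rw [mul_pow, mul_pow, show √y ^ 4 = (√y ^ 2) ^ 2 by ring, h2]
  field_simp

/-- The substitution u = √(d/m) y turns dy + m/y into √(dm)(u + 1/u), and the scaling factor is
(m/d)^(s/2). -/
lemma mellin_besselKernel {d m : ℕ} (hd : d ≠ 0) (hm : m ≠ 0) (s : ℂ) :
    (((d * m : ℕ) : ℂ) / (d : ℂ) ^ 2) ^ (s / 2) * besselK s (2 * Real.pi * √(d * m : ℕ))
      = 1 / 2 * mellin (fun y => (besselKernel d m y : ℂ)) s := by
  have hd0 : (0 : ℝ) < d := by positivity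
  have hm0 : (0 : ℝ) < m := by positivity
  set α : ℝ := √d with hα
  set β : ℝ := √m with hβ
  have hα0 : 0 < α := Real.sqrt_pos.2 hd0
  have hβ0 : 0 < β := Real.sqrt_pos.2 hm0
  have hα2 : α ^ 2 = d := Real.sq_sqrt hd0.le
  have hβ2 : β ^ 2 = m := Real.sq_sqrt hm0.le
  have hr : 0 < α / β := by positivity
  have hsq : √(d * m : ℕ) = α * β := by
    rw [Nat.cast_mul, Real.sqrt_mul hd0.le]
  have h1 := mellin_comp_mul_left (fun u : ℝ => (Real.exp (-(2 * Real.pi * (α * β) / 2) * (u + 1 / u)) : ℂ))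
    s hr
  have h2 : mellin (fun u : ℝ => (Real.exp (-(2 * Real.pi * (α * β) / 2) * (α / β * u + 1 / (α / β * u))) : ℂ)) s
      = mellin (fun y => (besselKernel d m y : ℂ)) s := by
    refine setIntegral_congr_fun measurableSet_Ioi fun y hy => ?_
    have hy0 : (0 : ℝ) < y := hy
    dsimp only
    rw [besselKernel, ← hα2, ← hβ2]
    congr 2
    field_simp
  have h3 : (((d * m : ℕ) : ℂ) / (d : ℂ) ^ 2) ^ (s / 2) = ((α / β : ℝ) : ℂ) ^ (-s) := by
    have e1 : (((d * m : ℕ) : ℂ) / (d : ℂ) ^ 2) = (((β / α) ^ (2 : ℕ) : ℝ) : ℂ) := by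
      rw [div_pow, hα2, hβ2]
      push_cast
      field_simp
    have e2 : (β / α) ^ (2 : ℕ) ≠ 0 := by positivity
    rw [e1, Complex.cpow_def_of_ne_zero (Complex.ofReal_ne_zero.2 e2),
      Complex.cpow_def_of_ne_zero (Complex.ofReal_ne_zero.2 hr.ne'), ← Complex.ofReal_log (by positivity),
      ← Complex.ofReal_log hr.le, Real.log_pow, Real.log_div hβ0.ne' hα0.ne',
      Real.log_div hα0.ne' hβ0.ne']
    push_cast
    ring_nf
  rw [h3, besselK, hsq, ← h2, h1, smul_eq_mul]
  simp only [mellin, smul_eq_mul]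
  ring

lemma mellinConvergent_doubleTerm (p : ℕ × ℕ) (s : ℂ) :
    MellinConvergent (fun y => (doubleTerm (p.1 + 1) (p.2 + 1) y : ℂ)) s :=
  mellinConvergent_of_le_expWeight
    (Complex.continuous_ofReal.comp_continuousOn (continuousOn_doubleTerm _ _))
    (fun _ hy => (Complex.norm_real _).trans_le (abs_doubleTerm_le_termBound p hy)) s

lemma continuousOn_expWeight : ContinuousOn expWeight (Ioi 0) := by
  unfold expWeight
  have h : ContinuousOn (fun y : ℝ => y⁻¹) (Ioi 0) := continuousOn_inv₀.mono fun _ hy => ne_of_gt hy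
  fun_prop

lemma summable_integral_norm_doubleTerm (s : ℂ) :
    Summable fun p : ℕ × ℕ => ∫ y in Ioi (0 : ℝ),
      ‖(y : ℂ) ^ (s - 1) • (doubleTerm (p.1 + 1) (p.2 + 1) y : ℂ)‖ := by
  have hw : MellinConvergent (fun y => (expWeight y : ℂ)) s :=
    mellinConvergent_of_le_expWeight (c := 1)
      (Complex.continuous_ofReal.comp_continuousOn continuousOn_expWeight)
      (fun y hy => by
        rw [Function.comp_apply, Complex.norm_real, Real.norm_of_nonneg (expWeight_nonneg hy), one_mul]) s
  refine .of_nonneg_of_le (fun p => integral_nonneg fun y => norm_nonneg _) (fun p => ?_)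
    (summable_termBound.mul_right (∫ y in Ioi (0 : ℝ), ‖(y : ℂ) ^ (s - 1) • (expWeight y : ℂ)‖))
  rw [← integral_const_mul]
  refine setIntegral_mono_on (mellinConvergent_doubleTerm p s).norm (hw.norm.const_mul _)
    measurableSet_Ioi fun y hy => ?_
  rw [norm_smul, norm_smul, Complex.norm_real, Complex.norm_real,
    Real.norm_of_nonneg (expWeight_nonneg hy), mul_left_comm]
  exact mul_le_mul_of_nonneg_left (abs_doubleTerm_le_termBound p hy) (norm_nonneg _)

lemma hasSum_mellin_doubleTerm (s : ℂ) :
    HasSum (fun p : ℕ × ℕ => mellin (fun y => (doubleTerm (p.1 + 1) (p.2 + 1) y : ℂ)) s)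
      (mellin (fun y => (psiKernel y : ℂ)) s) := by
  have h := hasSum_integral_of_summable_integral_norm (μ := volume.restrict (Ioi (0 : ℝ)))
    (F := fun (p : ℕ × ℕ) (y : ℝ) => (y : ℂ) ^ (s - 1) • (doubleTerm (p.1 + 1) (p.2 + 1) y : ℂ))
    (fun p => mellinConvergent_doubleTerm p s) (summable_integral_norm_doubleTerm s)
  have e : mellin (fun y => (psiKernel y : ℂ)) s = ∫ y in Ioi (0 : ℝ),
      ∑' p : ℕ × ℕ, (y : ℂ) ^ (s - 1) • (doubleTerm (p.1 + 1) (p.2 + 1) y : ℂ) := by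
    refine integral_congr_ae (Eventually.of_forall fun y => ?_)
    simp only [psiKernel, Complex.ofReal_tsum, smul_eq_mul, tsum_mul_left]
  rw [e]
  exact h

/-- The 2π of Ψ₂ against the 1/2 in the Bessel integral leaves the π of the logarithmic derivative.
-/
lemma besselTerm_eq {j : ℕ} (hj : j ≠ 0) (s : ℂ) :
    2 * Real.pi * besselTerm s j
      = ∑ d ∈ j.divisors, mellin (fun y => (doubleTerm d (j / d) y : ℂ)) s := by
  rw [besselTerm, c2, Finset.sum_mul, Finset.mul_sum]
  refine Finset.sum_congr rfl fun d hd => ?_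
  have hdvd := Nat.dvd_of_mem_divisors hd
  have hd0 : d ≠ 0 := (Nat.pos_of_mem_divisors hd).ne'
  have hm0 : j / d ≠ 0 := (Nat.div_pos (Nat.le_of_dvd (Nat.pos_of_ne_zero hj) hdvd)
    (Nat.pos_of_ne_zero hd0)).ne'
  have h := mellin_besselKernel hd0 hm0 s
  rw [Nat.mul_div_cancel' hdvd] at h
  have h2 : mellin (fun y => (doubleTerm d (j / d) y : ℂ)) s
      = (Real.pi * (a2 d * b2 (j / d)) : ℝ) • mellin (fun y => (besselKernel d (j / d) y : ℂ)) s := by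
    rw [← mellin_const_smul]
    congr 1
    ext y
    simp [doubleTerm]
  rw [h2, Complex.real_smul, mul_assoc (_ * _), h]
  push_cast
  ring

theorem summable_norm_besselTerm (s : ℂ) : Summable fun j : ℕ => ‖besselTerm s (j + 1)‖ := by
  have h : Summable fun p : ℕ × ℕ =>
      ‖mellin (fun y => (doubleTerm (p.1 + 1) (p.2 + 1) y : ℂ)) s‖ :=
    .of_nonneg_of_le (fun _ => norm_nonneg _) (fun p => norm_integral_le_integral_norm _)
      (summable_integral_norm_doubleTerm s)
  have h2 := (hasSum_divisors_of_prod
    (f := fun d m => ‖mellin (fun y => (doubleTerm d m y : ℂ)) s‖) h.hasSum).summable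
  refine .of_nonneg_of_le (fun _ => norm_nonneg _) (fun j => ?_) h2
  have h3 : ‖2 * Real.pi * besselTerm s (j + 1)‖ = 2 * Real.pi * ‖besselTerm s (j + 1)‖ := by
    rw [norm_mul, norm_mul, Complex.norm_real, Real.norm_of_nonneg Real.pi_nonneg]
    simp
  have h4 : ‖besselTerm s (j + 1)‖ ≤ 2 * Real.pi * ‖besselTerm s (j + 1)‖ :=
    le_mul_of_one_le_left (norm_nonneg _) (by linarith [Real.pi_gt_three])
  refine h4.trans ?_
  rw [← h3, besselTerm_eq j.succ_ne_zero]
  exact norm_sum_le _ _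

theorem Psi2_eq_mellin (s : ℂ) : Psi2 s = mellin (fun y => (psiKernel y : ℂ)) s := by
  have h := hasSum_divisors_of_prod
    (f := fun d m => mellin (fun y => (doubleTerm d m y : ℂ)) s) (hasSum_mellin_doubleTerm s)
  rw [Psi2, ← tsum_mul_left, ← h.tsum_eq]
  exact tsum_congr fun j => besselTerm_eq j.succ_ne_zero s

lemma norm_psiKernel_le (y : ℝ) (hy : 0 < y) :
    ‖(psiKernel y : ℂ)‖ ≤ (∑' p, termBound p) * expWeight y :=
  (Complex.norm_real _).trans_le (abs_psiKernel_le hy)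

lemma continuousOn_psiKernel_ofReal : ContinuousOn (fun y => (psiKernel y : ℂ)) (Ioi 0) :=
  Complex.continuous_ofReal.comp_continuousOn continuousOn_psiKernel

theorem differentiable_Psi2 : Differentiable ℂ Psi2 := by
  rw [funext Psi2_eq_mellin]
  exact differentiable_mellin_of_le_expWeight continuousOn_psiKernel_ofReal norm_psiKernel_le

/-! ### Integration by parts and the Bessel expansion -/

/-- The quotient `θ₄⁴/θ₃²`. -/
def thetaQuot (y : ℝ) : ℝ := theta4 y ^ 4 / theta3 y ^ 2

lemma hasDerivAt_thetaQuot {y : ℝ} (hy : 0 < y) : HasDerivAt thetaQuot (psiKernel y / y) y := by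
  have h3 := (theta3_pos hy).ne'
  have h4 := (theta4_pos hy).ne'
  have h := ((hasDerivAt_theta4 hy).1.pow 4).div ((hasDerivAt_theta3 hy).1.pow 2) (pow_ne_zero 2 h3)
  refine h.congr_deriv ?_
  rw [psiKernel_eq hy]
  simp only [Pi.pow_apply]
  field_simp
  push_cast
  ring

lemma thetaQuot_nonneg {y : ℝ} (hy : 0 < y) : 0 ≤ thetaQuot y := by
  have := theta3_pos hy
  unfold thetaQuot
  positivity

/-- Follows from θ₄ ≤ 1 and θ₄ ≤ θ₃, the latter by Jacobi's identity. The bound controls h - 1 near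
0, for convergence and for the boundary term. -/
lemma thetaQuot_le_one {y : ℝ} (hy : 0 < y) : thetaQuot y ≤ 1 := by
  have h3 := theta3_pos hy
  have h4 := theta4_pos hy
  have h43 : theta4 y ≤ theta3 y := by
    refine le_of_pow_le_pow_left₀ four_ne_zero h3.le ?_
    rw [theta3_pow_four hy]
    have := theta2_pos hy
    linarith [pow_pos this 4]
  rw [thetaQuot, div_le_one (by positivity)]
  have h1 := theta4_le_one hy
  calc theta4 y ^ 4 ≤ theta4 y ^ 2 := pow_le_pow_of_le_one h4.le h1 (by norm_num)
    _ ≤ theta3 y ^ 2 := by gcongr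

lemma abs_thetaQuot_sub_one_le {y : ℝ} (hy : 0 < y) : |thetaQuot y - 1| ≤ 1 := by
  rw [abs_le]
  constructor <;> linarith [thetaQuot_nonneg hy, thetaQuot_le_one hy]

open Asymptotics in
lemma isBigO_thetaQuot_sub_one (r : ℝ) :
    (fun y : ℝ => ((thetaQuot y - 1 : ℝ) : ℂ)) =O[atTop] (· ^ r) := by
  obtain ⟨p, hp, h3⟩ := isBigO_theta3_sub_one
  obtain ⟨p', hp', h4⟩ := isBigO_theta4_sub_one
  have e3 := (isBigO_pow_sub_one tendsto_theta3 h3 2).trans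
    (isLittleO_exp_neg_mul_rpow_atTop hp r).isBigO
  have e4 := (isBigO_pow_sub_one tendsto_theta4 h4 4).trans
    (isLittleO_exp_neg_mul_rpow_atTop hp' r).isBigO
  have hinv : (fun y => (theta3 y ^ 2)⁻¹) =O[atTop] fun _ => (1 : ℝ) :=
    ((tendsto_theta3.pow 2).inv₀ (by norm_num)).isBigO_one ℝ
  have h : (fun y => thetaQuot y - 1) =O[atTop] (· ^ r) := by
    have h5 := hinv.mul (e4.sub e3)
    simp only [one_mul] at h5
    refine h5.congr' ?_ EventuallyEq.rfl
    filter_upwards [eventually_gt_atTop 0] with y hy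
    have := (theta3_pos hy).ne'
    rw [thetaQuot]
    field_simp
    ring
  refine IsBigO.of_norm_left (h.norm_left.congr_left fun y => ?_)
  rw [Complex.norm_real]

open Asymptotics in
lemma mellinConvergent_thetaQuot_sub_one {s : ℂ} (hs : 0 < s.re) :
    MellinConvergent (fun y => ((thetaQuot y - 1 : ℝ) : ℂ)) s := by
  have hc : ContinuousOn (fun y => ((thetaQuot y - 1 : ℝ) : ℂ)) (Ioi 0) :=
    Complex.continuous_ofReal.comp_continuousOn fun y hy =>
      ((hasDerivAt_thetaQuot hy).sub_const 1).continuousAt.continuousWithinAt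
  refine mellinConvergent_of_isBigO_rpow (hc.locallyIntegrableOn measurableSet_Ioi)
    (isBigO_thetaQuot_sub_one (-(s.re + 1))) (by linarith) (b := 0) ?_ hs
  refine IsBigO.of_bound 1 ?_
  filter_upwards [self_mem_nhdsWithin] with y hy
  rw [Complex.norm_real, neg_zero, Real.rpow_zero, norm_one, one_mul]
  exact abs_thetaQuot_sub_one_le hy

/-- Integration by parts of y^s against h'. Taking h - 1 as primitive kills the boundary term at
infinity; at 0 boundedness and Re s > 0 suffice. -/
theorem Psi2_eq_neg_mul_mellin {s : ℂ} (hs : 0 < s.re) :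
    Psi2 s = -(s * mellin (fun y => ((thetaQuot y - 1 : ℝ) : ℂ)) s) := by
  have hs0 : s ≠ 0 := by
    rintro rfl
    simp at hs
  have hconv := mellinConvergent_thetaQuot_sub_one hs
  have hconvΨ := mellinConvergent_of_le_expWeight continuousOn_psiKernel_ofReal norm_psiKernel_le s
  have hcpow : ∀ y ∈ Ioi (0 : ℝ), (y : ℂ) ^ s * ((psiKernel y / y : ℝ) : ℂ)
      = (y : ℂ) ^ (s - 1) * (psiKernel y : ℂ) := by
    intro y hy
    have hy0 : (y : ℂ) ≠ 0 := Complex.ofReal_ne_zero.2 (ne_of_gt hy)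
    rw [Complex.cpow_sub _ _ hy0, Complex.cpow_one, Complex.ofReal_div]
    ring
  have h := integral_Ioi_mul_deriv_eq_deriv_mul (a := 0) (a' := (0 : ℂ)) (b' := 0)
    (u := fun y : ℝ => (y : ℂ) ^ s) (u' := fun y : ℝ => s * (y : ℂ) ^ (s - 1))
    (v := fun y => ((thetaQuot y - 1 : ℝ) : ℂ)) (v' := fun y => ((psiKernel y / y : ℝ) : ℂ))
    (fun y hy => hasDerivAt_ofReal_cpow_const (ne_of_gt hy) hs0)
    (fun y hy => ((hasDerivAt_thetaQuot hy).sub_const 1).ofReal_comp) ?_ ?_ ?_ ?_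
  · rw [setIntegral_congr_fun measurableSet_Ioi hcpow] at h
    rw [Psi2_eq_mellin]
    simp only [mellin, smul_eq_mul]
    rw [h, sub_zero, zero_sub, ← integral_const_mul]
    simp only [mul_assoc]
  · exact (integrableOn_congr_fun hcpow measurableSet_Ioi).2 hconvΨ
  · refine (hconv.const_mul s).congr (Eventually.of_forall fun y => ?_)
    simp only [Pi.mul_apply, smul_eq_mul, mul_assoc]
  · refine squeeze_zero_norm' (a := fun y : ℝ => y ^ s.re) ?_ ?_
    · filter_upwards [self_mem_nhdsWithin] with y hy
      rw [Pi.mul_apply, norm_mul, Complex.norm_cpow_eq_rpow_re_of_pos hy, Complex.norm_real]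
      exact mul_le_of_le_one_right (Real.rpow_nonneg (le_of_lt hy) _) (abs_thetaQuot_sub_one_le hy)
    · have := (Real.continuousAt_rpow_const 0 s.re (Or.inr hs.le)).tendsto
      rw [Real.zero_rpow hs.ne'] at this
      exact this.mono_left nhdsWithin_le_nhds
  · have h1 : (fun y : ℝ => (y : ℂ) ^ s) =O[atTop] fun y : ℝ => y ^ s.re := by
      refine Asymptotics.IsBigO.of_bound 1 ?_
      filter_upwards [eventually_gt_atTop 0] with y hy
      rw [Complex.norm_cpow_eq_rpow_re_of_pos hy, one_mul]
      exact le_abs_self _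
    have h2 := h1.mul (isBigO_thetaQuot_sub_one (-s.re - 1))
    refine h2.trans_tendsto ((tendsto_rpow_neg_atTop one_pos).congr' ?_)
    filter_upwards [eventually_gt_atTop 0] with y hy
    rw [← Real.rpow_add hy]
    congr 1
    ring

lemma inv_mul_thetaQuot_inv_sub_one {y : ℝ} (hy : 0 < y) :
    y⁻¹ * (thetaQuot y⁻¹ - 1) = theta2 y ^ 4 / theta3 y ^ 2 - 1 / y := by
  have h3 := (theta3_pos hy).ne'
  rw [thetaQuot, ← one_div, theta4_inv hy, theta3_inv hy, mul_pow, mul_pow,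
    show √y ^ 4 = (√y ^ 2) ^ 2 by ring, Real.sq_sqrt hy.le]
  field_simp

/-- Jacobi's identity divided by θ₃²; the constants -1 and -1/y fall one on each half. -/
lemma thetaQuot_add {y : ℝ} (hy : 0 < y) :
    (thetaQuot y - 1) + y⁻¹ * (thetaQuot y⁻¹ - 1) = theta3 y ^ 2 - 1 - 1 / y := by
  have h3 := (theta3_pos hy).ne'
  rw [inv_mul_thetaQuot_inv_sub_one hy, thetaQuot]
  have : theta4 y ^ 4 / theta3 y ^ 2 + theta2 y ^ 4 / theta3 y ^ 2 = theta3 y ^ 2 := by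
    rw [← add_div, add_comm, ← theta3_pow_four hy]
    field_simp
  linarith

lemma mellin_add_mellin_one_sub {s : ℂ} (hs0 : 0 < s.re) (hs1 : s.re < 1) :
    mellin (fun y => ((thetaQuot y - 1 : ℝ) : ℂ)) s
      + mellin (fun y => ((thetaQuot y - 1 : ℝ) : ℂ)) (1 - s) = thetaSqPair.Λ s := by
  have hs1' : 0 < (1 - s).re := by simpa using hs1
  rw [← (hasMellin_strip hs0 hs1).2]
  -- Under y ↦ 1/y the transform of y⁻¹f(1/y) at s is that of f at 1 - s.
  have h1 := mellin_comp_inv (fun y => ((thetaQuot y - 1 : ℝ) : ℂ)) (s - 1)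
  have h2 := mellin_cpow_smul (fun y : ℝ => ((thetaQuot y⁻¹ - 1 : ℝ) : ℂ)) s (-1)
  rw [neg_sub] at h1
  rw [← sub_eq_add_neg, h1] at h2
  rw [← h2, mellin, mellin, ← integral_add (mellinConvergent_thetaQuot_sub_one hs0)]
  · refine setIntegral_congr_fun measurableSet_Ioi fun y hy => ?_
    dsimp only
    rw [← smul_add, smul_eq_mul, smul_eq_mul, Complex.cpow_neg_one, ← thetaQuot_add hy]
    push_cast
    rfl
  · refine (((hasMellin_strip hs0 hs1).1.sub (mellinConvergent_thetaQuot_sub_one hs0)).congr_fun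
      (fun y hy => ?_) measurableSet_Ioi)
    dsimp only [Pi.sub_apply]
    rw [smul_eq_mul, smul_eq_mul, smul_eq_mul, Complex.cpow_neg_one, ← thetaQuot_add hy]
    push_cast
    ring

lemma Λ_eq_neg_Psi2_of_mem_strip {s : ℂ} (hs0 : 0 < s.re) (hs1 : s.re < 1) :
    thetaSqPair.Λ s = -(Psi2 s / s + Psi2 (1 - s) / (1 - s)) := by
  have hs1' : 0 < (1 - s).re := by simpa using hs1
  have e0 : s ≠ 0 := by
    rintro rfl
    simp at hs0
  have e1 : 1 - s ≠ 0 := by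
    intro h
    simp [h] at hs1'
  rw [← mellin_add_mellin_one_sub hs0 hs1, Psi2_eq_neg_mul_mellin hs0, Psi2_eq_neg_mul_mellin hs1']
  field_simp
  ring

theorem Λ_eq_neg_Psi2 {s : ℂ} (h0 : s ≠ 0) (h1 : s ≠ 1) :
    thetaSqPair.Λ s = -(Psi2 s / s + Psi2 (1 - s) / (1 - s)) := by
  -- This is z(1-z)Λ(z) with the poles cleared, since z(1-z)(1/z + 1/(1-z)) = 1. Both `f` and `g`
  -- are entire, so agreement near 1/2 suffices.
  let f : ℂ → ℂ := fun z => z * (1 - z) * thetaSqPair.Λ₀ z - 1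
  let g : ℂ → ℂ := fun z => -((1 - z) * Psi2 z + z * Psi2 (1 - z))
  have hf : Differentiable ℂ f := by
    have := thetaSqPair.differentiable_Λ₀
    fun_prop
  have hg : Differentiable ℂ g := by
    have := differentiable_Psi2
    fun_prop
  have hfΛ : ∀ z : ℂ, z ≠ 0 → 1 - z ≠ 0 → f z = z * (1 - z) * thetaSqPair.Λ z := by
    intro z hz hz1
    rw [thetaSqPair_Λ_eq]
    simp only [f]
    field_simp
    ring
  have hgΨ : ∀ z : ℂ, z ≠ 0 → 1 - z ≠ 0 →
      g z = z * (1 - z) * -(Psi2 z / z + Psi2 (1 - z) / (1 - z)) := by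
    intro z hz hz1
    simp only [g]
    field_simp
  have hev : f =ᶠ[𝓝 (1 / 2)] g := by
    have ha : ∀ᶠ z : ℂ in 𝓝 (1 / 2), 0 < z.re :=
      Complex.continuous_re.continuousAt.eventually_const_lt (by norm_num)
    have hb : ∀ᶠ z : ℂ in 𝓝 (1 / 2), z.re < 1 :=
      Complex.continuous_re.continuousAt.eventually_lt_const (by norm_num)
    filter_upwards [ha, hb] with z hz0 hz1
    have e0 : z ≠ 0 := by
      rintro rfl
      simp at hz0
    have e1 : 1 - z ≠ 0 := by
      rw [sub_ne_zero]
      rintro rfl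
      simp at hz1
    rw [hfΛ z e0 e1, hgΨ z e0 e1, Λ_eq_neg_Psi2_of_mem_strip hz0 hz1]
  have hfg : f = g := AnalyticOnNhd.eq_of_eventuallyEq
    (fun z _ => hf.analyticAt z) (fun z _ => hg.analyticAt z) hev
  have e1 : 1 - s ≠ 0 := sub_ne_zero.2 h1.symm
  have h := congrFun hfg s
  rw [hfΛ s h0 e1, hgΨ s h0 e1] at h
  exact mul_left_cancel₀ (mul_ne_zero h0 e1) h

end

end BesselZeta

theorem mainTheorem4 :
    -- the sequences `a₂`, `b₂` are the coefficients of the stated `q`-expansions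
    (∀ y : ℝ, 0 < y →
      HasSum (fun n : ℕ => Real.pi * (BesselZeta.a2 (n + 1) * BesselZeta.nome y ^ (n + 1)))
        (4 * (deriv BesselZeta.theta4 y / BesselZeta.theta4 y)
          - 2 * (deriv BesselZeta.theta3 y / BesselZeta.theta3 y))) ∧
    (∀ y : ℝ, 0 < y →
      HasSum (fun m : ℕ => BesselZeta.b2 (m + 1) * BesselZeta.nome y ^ (m + 1))
        (BesselZeta.theta3 y ^ 2 * BesselZeta.lam y)) ∧
    -- `ζ*(s, 2)` is given by the theta integral in the critical strip ...
    (∀ s : ℂ, 0 < s.re → s.re < 1 →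
      MeasureTheory.IntegrableOn
        (fun y : ℝ => (y : ℂ) ^ (s - 1) * ((BesselZeta.theta3 y ^ 2 - 1 - 1 / y : ℝ) : ℂ))
        (Set.Ioi 0) ∧
      BesselZeta.zetaStar2 s =
        1 / 4 * ∫ y in Set.Ioi (0 : ℝ),
          (y : ℂ) ^ (s - 1) * ((BesselZeta.theta3 y ^ 2 - 1 - 1 / y : ℝ) : ℂ)) ∧
    -- ... and by the product of `ζ` and `L` wherever none of the factors has a pole
    (∀ s : ℂ, s ≠ 1 → (∀ n : ℕ, s ≠ -(n : ℂ)) →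
      BesselZeta.zetaStar2 s =
        (Real.pi : ℂ) ^ (-s) * Complex.Gamma s * riemannZeta s * BesselZeta.chi.LFunction s) ∧
    -- the Bessel series converges absolutely for every `s`
    (∀ s : ℂ, Summable (fun j : ℕ => ‖BesselZeta.besselTerm s (j + 1)‖)) ∧
    -- the Bessel expansion
    (∀ s : ℂ, s ≠ 0 → s ≠ 1 →
      4 * BesselZeta.zetaStar2 s =
        -(BesselZeta.Psi2 s / s + BesselZeta.Psi2 (1 - s) / (1 - s))) := by
  refine ⟨fun y hy => BesselZeta.hasSum_a2 hy, fun y hy => ?_, fun s h0 h1 => ?_,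
    fun s h1 h => BesselZeta.zetaStar2_eq_zetaProduct h1 h, BesselZeta.summable_norm_besselTerm,
    fun s h0 h1 => ?_⟩
  · rw [BesselZeta.theta3_sq_mul_lam hy]
    exact BesselZeta.hasSum_b2 hy
  · have hs0 : s ≠ 0 := by
      rintro rfl
      simp at h0
    have hs1 : s ≠ 1 := by
      rintro rfl
      simp at h1
    obtain ⟨hint, hΛ⟩ := BesselZeta.hasMellin_strip h0 h1
    refine ⟨hint, ?_⟩
    rw [hΛ, BesselZeta.zetaStar2_eq_Λ hs0 hs1]
    ring
  · rw [BesselZeta.zetaStar2_eq_Λ h0 h1, ← BesselZeta.Λ_eq_neg_Psi2 h0 h1]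
    ring
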